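/- Let $m,n$ be perfect squares and $X^0\in\mathbb R^{\sqrt n\times\sqrt n}$ a fixed matrix with exactly $k$ nonzero entries, where $k\le \tfrac12\sqrt n$. Let $A,B\in\mathbb R^{\sqrt m\times\sqrt n}$ be random matrices all of whose entries are jointly independent (not necessarily identically distributed) and strictly sub-Gaussian with variance $1/m$, i.e. every entry $\xi$ satisfies $\mathbb E\,\xi=0$, $\mathbb E\,\xi^2=1/m$ and $\mathbb E\,e^{t\xi}\le e^{t^2/(2m)}$ for all $t\in\mathbb R$. Consider the convex program $$(\mathrm P_2)\qquad \hat X=\operatorname{argmin}_{X\in\mathbb R^{\sqrt n\times\sqrt n}}\ \|X\|_1:=\sum_{i,j}|X_{ij}|\quad\text{subject to}\quad AXB^T=Y,\qquad Y:=AX^0B^T .$$ If $$m\ \ge\ 225\,k^2\bigl(\log(n/k^2)\bigr)^2$$ (the right-hand side being read as $0$ when $k=0$), then $(\mathrm P_2)$ attains perfect recovery, i.e. $X^0$ is its unique minimizer $\hat X$, with $$\mathbb P\bigl(\hat X=X^0\bigr)\ \ge\ 1-4\exp\bigl(-0.1\sqrt m\bigr).$$ -/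

import Mathlib

open MeasureTheory ProbabilityTheory
open scoped NNReal Matrix

/-- A random variable `X` is strictly sub-Gaussian with variance `v`: it has mean zero,
`𝔼 X² = v`, and `𝔼 exp (t X) ≤ exp (v t² / 2)` for every real `t`.
(`HasSubgaussianMGF X v μ` says that each `exp (t X)` is integrable and that this bound holds.) -/
structure IsStrictlySubGaussian {Ω : Type*} [MeasurableSpace Ω] (X : Ω → ℝ) (v : ℝ≥0)
    (μ : Measure Ω) : Prop where
  mean_eq_zero : ∫ ω, X ω ∂μ = 0
  second_moment : ∫ ω, (X ω) ^ 2 ∂μ = (v : ℝ)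
  mgf_bound : HasSubgaussianMGF X v μ

/-- `‖X‖₀`, the number of nonzero entries of a matrix. -/
noncomputable def matrixL0 {a b : ℕ} (X : Matrix (Fin a) (Fin b) ℝ) : ℕ :=
  Set.ncard {e : Fin a × Fin b | X e.1 e.2 ≠ 0}

/-- `‖X‖₁`, the sum of the absolute values of the entries of a matrix. -/
def matrixL1 {a b : ℕ} (X : Matrix (Fin a) (Fin b) ℝ) : ℝ :=
  ∑ i, ∑ j, |X i j|

/-- The set of all minimizers of `‖X‖₁` subject to `A X Bᵀ = Y`. -/
def kcsSolutions {m₁ m₂ n₁ n₂ : ℕ} (A : Matrix (Fin m₁) (Fin n₁) ℝ)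
    (B : Matrix (Fin m₂) (Fin n₂) ℝ) (Y : Matrix (Fin m₁) (Fin m₂) ℝ) :
    Set (Matrix (Fin n₁) (Fin n₂) ℝ) :=
  {X | A * X * Bᵀ = Y ∧
    ∀ X' : Matrix (Fin n₁) (Fin n₂) ℝ, A * X' * Bᵀ = Y → matrixL1 X ≤ matrixL1 X'}

/-- Perfect recovery of `X₀`: with data `Y = A X₀ Bᵀ`, the matrix `X₀` is the one and only
minimizer. -/
def PerfectRecovery {m₁ m₂ n₁ n₂ : ℕ} (A : Matrix (Fin m₁) (Fin n₁) ℝ)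
    (B : Matrix (Fin m₂) (Fin n₂) ℝ) (X₀ : Matrix (Fin n₁) (Fin n₂) ℝ) : Prop :=
  kcsSolutions A B (A * X₀ * Bᵀ) = {X₀}

/-- The family of all entries of two random matrices. -/
def allEntries {Ω : Type*} {m₁ m₂ n₁ n₂ : ℕ} (A : Ω → Matrix (Fin m₁) (Fin n₁) ℝ)
    (B : Ω → Matrix (Fin m₂) (Fin n₂) ℝ) :
    (Fin m₁ × Fin n₁) ⊕ (Fin m₂ × Fin n₂) → Ω → ℝ
  | Sum.inl e => fun ω => A ω e.1 e.2
  | Sum.inr e => fun ω => B ω e.1 e.2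

/-!
The failure of recovery is excluded by a dual certificate of product form. Let `H ≠ 0` satisfy
`A H Bᵀ = 0`, let `S₁`, `S₂` be the sets of nonzero rows and columns of `X₀`, and let `Σ` be its
sign matrix. Suppose `R₁`, `R₂` are linear maps sending the columns of `A` (of `B`) indexed by
`S₁` (by `S₂`) to the standard basis vectors. The matrix `Γ` with entries `⟨R₁ aᵢ, Σ R₂ bⱼ⟩`
annihilates `H` and equals `Σ` on `S₁ × S₂`, so recovery follows if `Γ` is less than one, in an
averaged sense, off `S₁ × S₂`. A fixed pair of maps does not achieve this. However, the maps may
depend on `H`: they are required to kill the `k` columns `T` off the support on which `H` is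
largest, and then only the total excess of `‖C R aᵢ‖` over the level `0.97`, with `C = Σᵀ` or
`C = Σ`, has to be at most `0.97 k`. This is `HasDualCertificate`; its sufficiency is
`abs_sum_mul_le_of_hasDualCertificate` together with `perfectRecovery_of_hasDualCertificate`. Since
the condition concerns one matrix at a time, no independence between `A` and `B` is needed.

For fixed `T` the map `R` is given by the vectors dual to the columns indexed by `S ∪ T`
(`dualFamily`), and its norm is controlled by `blockGap`, the squared least singular value of the
columns in `S` modulo those in `T`. For a given value `l` of `blockGap`, the remaining columns are
independent of `R`, and both `‖R aᵢ‖ > 1` and a large total excess have conditional probability of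
order `exp (-0.42 l)`, up to factors exponential in `k` or in a small multiple of the dimension.
So everything rests on a bound for `𝔼 exp (-0.42 l)`
(`lintegral_indicator_exp_neg_blockGap_le`), which is obtained from a net of the unit sphere of
`ℝ^S` and from the bound `𝔼 exp (-(2/5) d(z, W)²) ≤ exp (-0.263 m) √5 ^ dim W` for a fixed subspace
`W` and a vector `z` with independent strictly sub-Gaussian coordinates. The latter follows, by
introducing a Gaussian vector and exchanging the two integrations
(`lintegral_exp_mul_sum_inner_sq_le`), from the scalar estimate
`𝔼 exp (-(2/5) ξ² + u ξ) ≤ exp (-0.263 + u² / 2)`, where strict sub-Gaussianity enters through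
`𝔼 ξ³ = 0` and `𝔼 ξ⁴ ≤ 3`.

The union over the `n.choose k` sets `T` is affordable when `n ≥ 16 k`. For `n < 16 k` the
hypothesis forces `m ≥ 5 n`, and then both matrices are injective with high probability.
-/

open scoped ENNReal

/-! ### Elementary bounds for the exponential -/

/-- A quadratic majorant of `exp (-u)` on the half line, equal to it at `0` and almost tangent to
it near `u = 6/5`. -/
theorem exp_neg_le_quadratic_near {u : ℝ} (hu : 0 ≤ u) :
    Real.exp (-u) ≤ 1 - 69/80*u + 15/64*u^2 := by
  have h := Real.sum_le_exp_of_nonneg hu 7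
  simp only [Finset.sum_range_succ, Finset.sum_range_zero, Nat.factorial] at h
  norm_num at h
  have hq : 0 < 1 - 69/80*u + 15/64*u^2 := by nlinarith [sq_nonneg (u - 46/25)]
  rw [Real.exp_neg, inv_le_comm₀ (Real.exp_pos u) hq]
  refine le_trans ?_ h
  rw [inv_le_iff_one_le_mul₀ hq]
  -- the product of the quadratic and the Taylor polynomial exceeds `1` by a nonnegative
  -- combination of the `key i`, `u` and `u ^ 2`
  have key (i : ℕ) : 0 ≤ u ^ i * (u * (u - 1197/1000)^2) := by positivity
  linarith [key 0, key 1, key 2, key 3, key 4, key 5, hu, pow_nonneg hu 2]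

/-- A quadratic majorant of `exp (-u)` on the half line, equal to it at `0` and close to it near
`u = 3`. -/
theorem exp_neg_le_quadratic_far {u : ℝ} (hu : 0 ≤ u) :
    Real.exp (-u) ≤ 1 - 11/20*u + 13/160*u^2 := by
  have h := Real.sum_le_exp_of_nonneg hu 7
  simp only [Finset.sum_range_succ, Finset.sum_range_zero, Nat.factorial] at h
  norm_num at h
  have hq : 0 < 1 - 11/20*u + 13/160*u^2 := by nlinarith [sq_nonneg (u - 3.4)]
  rw [Real.exp_neg, inv_le_comm₀ (Real.exp_pos u) hq]
  refine le_trans ?_ h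
  rw [inv_le_iff_one_le_mul₀ hq]
  have key (i : ℕ) : 0 ≤ u ^ i * (u * (u - 3)^2) := by positivity
  linarith [key 0, key 1, key 2, key 3, key 4, key 5, hu, pow_nonneg hu 2]

/-- A Taylor polynomial of odd degree bounds the exponential from below on the whole line. -/
theorem Real.taylor_five_le_exp (u : ℝ) :
    1 + u + u^2/2 + u^3/6 + u^4/24 + u^5/120 ≤ Real.exp u := by
  rcases le_total 0 u with hu | hu
  · have h := Real.sum_le_exp_of_nonneg hu 6
    simpa [Finset.sum_range_succ, Nat.factorial] using h
  · obtain ⟨v, rfl⟩ : ∃ v, u = -v := ⟨-u, by simp⟩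
    have hv : 0 ≤ v := by linarith
    -- the successive remainders of `exp (-x)`, with alternating signs, vanish at `0`, and each is
    -- the derivative of the next
    have step : ∀ (f f' : ℝ → ℝ), (∀ x, HasDerivAt f (f' x) x) → f 0 = 0 →
        (∀ x, 0 ≤ x → 0 ≤ f' x) → ∀ x, 0 ≤ x → 0 ≤ f x := by
      intro f f' hd h0 hp x hx
      have : MonotoneOn f (Set.Ici 0) := by
        apply monotoneOn_of_deriv_nonneg (convex_Ici 0)
          (fun x _ => (hd x).continuousAt.continuousWithinAt)
          (fun x _ => (hd x).differentiableAt.differentiableWithinAt)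
        intro x hx
        rw [(hd x).deriv]
        exact hp x (by simpa using (interior_subset hx))
      have := this Set.self_mem_Ici hx hx
      linarith
    have e (x : ℝ) : HasDerivAt (fun x => Real.exp (-x)) (-Real.exp (-x)) x := by
      simpa using (hasDerivAt_neg x).exp
    have p (x : ℝ) (n : ℕ) (c : ℝ) :
        HasDerivAt (fun x : ℝ => x ^ n * c) ((n * x ^ (n-1)) * c) x := by
      simpa using (hasDerivAt_pow n x).mul_const c
    have a1 := step (fun x => 1 - Real.exp (-x)) _ (fun x => (e x).const_sub 1) (by simp)
      (fun x _ => by simpa using (Real.exp_pos (-x)).le)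
    have a2 := step (fun x => Real.exp (-x) - 1 + x ^ 1 * 1) _
      (fun x => ((e x).sub_const 1).add (p x 1 1)) (by simp)
      (fun x hx => by have := a1 x hx; norm_num at this ⊢; linarith)
    have a3 := step (fun x => 1 - Real.exp (-x) - x ^ 1 * 1 + x ^ 2 * (1/2)) _
      (fun x => (((e x).const_sub 1).sub (p x 1 1)).add (p x 2 (1/2))) (by simp)
      (fun x hx => by have := a2 x hx; norm_num at this ⊢; linarith)
    have a4 := step (fun x => Real.exp (-x) - 1 + x ^ 1 * 1 - x ^ 2 * (1/2) + x ^ 3 * (1/6)) _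
      (fun x => ((((e x).sub_const 1).add (p x 1 1)).sub (p x 2 (1/2))).add (p x 3 (1/6))) (by simp)
      (fun x hx => by have := a3 x hx; norm_num at this ⊢; linarith)
    have a5 := step (fun x => 1 - Real.exp (-x) - x ^ 1 * 1 + x ^ 2 * (1/2) - x ^ 3 * (1/6)
        + x ^ 4 * (1/24)) _
      (fun x => (((((e x).const_sub 1).sub (p x 1 1)).add (p x 2 (1/2))).sub (p x 3 (1/6))).add
        (p x 4 (1/24))) (by simp)
      (fun x hx => by have := a4 x hx; norm_num at this ⊢; linarith)
    have a6 := step (fun x => Real.exp (-x) - 1 + x ^ 1 * 1 - x ^ 2 * (1/2) + x ^ 3 * (1/6)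
        - x ^ 4 * (1/24) + x ^ 5 * (1/120)) _
      (fun x => ((((((e x).sub_const 1).add (p x 1 1)).sub (p x 2 (1/2))).add (p x 3 (1/6))).sub
        (p x 4 (1/24))).add (p x 5 (1/120))) (by simp)
      (fun x hx => by have := a5 x hx; norm_num at this ⊢; linarith)
    have := a6 v hv
    norm_num at this
    linarith

/-! ### Strictly sub-Gaussian variables -/

namespace IsStrictlySubGaussian
variable {Ω : Type*} [MeasurableSpace Ω] {μ : Measure Ω} {X : Ω → ℝ} {v : ℝ≥0}

theorem integrable_pow (h : IsStrictlySubGaussian X v μ) (p : ℕ) :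
    Integrable (fun ω => X ω ^ p) μ :=
  integrable_pow_of_mem_interior_integrableExpSet
    (by rw [h.mgf_bound.integrableExpSet_eq_univ]; simp) p

theorem integral_exp_le (h : IsStrictlySubGaussian X 1 μ) (t : ℝ) :
    ∫ ω, Real.exp (t * X ω) ∂μ ≤ Real.exp (t ^ 2 / 2) := by
  simpa [mgf] using h.mgf_bound.mgf_le t

theorem integrable_sum_pow (h : IsStrictlySubGaussian X v μ) {N : ℕ} (c : Fin N → ℝ) :
    Integrable (fun ω => ∑ i, c i * X ω ^ (i : ℕ)) μ :=
  integrable_finsetSum _ fun i _ => (h.integrable_pow i).const_mul _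

theorem integral_sum_pow (h : IsStrictlySubGaussian X v μ) {N : ℕ} (c : Fin N → ℝ) :
    ∫ ω, ∑ i, c i * X ω ^ (i : ℕ) ∂μ = ∑ i, c i * ∫ ω, X ω ^ (i : ℕ) ∂μ := by
  rw [integral_finsetSum _ fun (i : Fin N) _ => (h.integrable_pow (i : ℕ)).const_mul (c i)]
  simp_rw [integral_const_mul]

/-- The Taylor expansions in `t` of the two sides of `𝔼 exp (t X) ≤ exp (t² / 2)` agree up to order
two; this compares their higher terms. -/
theorem taylor_le [IsProbabilityMeasure μ] (h : IsStrictlySubGaussian X 1 μ) {t : ℝ}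
    (ht : |t| ≤ 1) :
    t ^ 3 / 6 * ∫ ω, X ω ^ 3 ∂μ + t ^ 4 / 24 * ∫ ω, X ω ^ 4 ∂μ + t ^ 5 / 120 * ∫ ω, X ω ^ 5 ∂μ
      ≤ t ^ 4 / 8 + t ^ 6 / 32 := by
  have key : ∫ ω, ∑ i, (![1, t, t^2/2, t^3/6, t^4/24, t^5/120] : Fin 6 → ℝ) i * X ω ^ (i : ℕ) ∂μ ≤
      ∫ ω, Real.exp (t * X ω) ∂μ := by
    refine integral_mono (h.integrable_sum_pow _) (h.mgf_bound.integrable_exp_mul t) fun ω => ?_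
    have := Real.taylor_five_le_exp (t * X ω)
    simp only [mul_pow] at this
    refine le_trans (le_of_eq ?_) this
    simp [Fin.sum_univ_succ]
    ring
  rw [h.integral_sum_pow] at key
  simp [Fin.sum_univ_succ, h.mean_eq_zero, h.second_moment] at key
  have h2 := key.trans (h.integral_exp_le t)
  have h3 : Real.exp (t^2/2) ≤ 1 + t^2/2 + t^4/8 + t^6/32 := by
    have ht2 : t ^ 2 ≤ 1 := by rw [← sq_abs]; nlinarith [abs_nonneg t]
    have := Real.exp_bound' (x := t^2/2) (by positivity) (by linarith) (n := 3) (by norm_num)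
    simp [Finset.sum_range_succ, Nat.factorial] at this
    nlinarith [pow_nonneg (sq_nonneg t) 3]
  linarith

/-- Otherwise the cubic term in `taylor_le` would dominate for small `t` of the appropriate
sign. -/
theorem third_moment [IsProbabilityMeasure μ] (h : IsStrictlySubGaussian X 1 μ) :
    ∫ ω, X ω ^ 3 ∂μ = 0 := by
  set a := ∫ ω, X ω ^ 3 ∂μ
  set b := ∫ ω, X ω ^ 4 ∂μ
  set c := ∫ ω, X ω ^ 5 ∂μ
  set K := 1 + |b| + |c|
  have hb := neg_abs_le b
  have hc := neg_abs_le c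
  have hc' := le_abs_self c
  have hb0 := abs_nonneg b
  have hc0 := abs_nonneg c
  have bound : ∀ t : ℝ, 0 < t → t ≤ 1 → |a| ≤ 6 * K * t := by
    intro t ht ht1
    have h1 := h.taylor_le (t := t) (by rw [abs_of_pos ht]; exact ht1)
    have h2 := h.taylor_le (t := -t) (by rw [abs_neg, abs_of_pos ht]; exact ht1)
    change t ^ 3 / 6 * a + t ^ 4 / 24 * b + t ^ 5 / 120 * c ≤ _ at h1
    change (-t) ^ 3 / 6 * a + (-t) ^ 4 / 24 * b + (-t) ^ 5 / 120 * c ≤ _ at h2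
    have t3 : 0 < t ^ 3 := by positivity
    have e4 : 0 ≤ t ^ 4 * |b| := by positivity
    have l4 : -(t ^ 4 * |b|) ≤ t ^ 4 * b := by nlinarith [pow_pos ht 4]
    have l5 : -(t ^ 5 * |c|) ≤ t ^ 5 * c := by nlinarith [pow_pos ht 5]
    have l5' : t ^ 5 * c ≤ t ^ 5 * |c| := by nlinarith [pow_pos ht 5]
    have l6 : t ^ 5 * |c| ≤ t ^ 4 * |c| := by
      have : t ^ 5 ≤ t ^ 4 := pow_le_pow_of_le_one ht.le ht1 (by norm_num)
      nlinarith
    have l7 : t ^ 6 ≤ t ^ 4 := pow_le_pow_of_le_one ht.le ht1 (by norm_num)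
    have l8 : 0 ≤ t ^ 4 * |c| := by positivity
    have l9 := pow_pos ht 4
    have : t ^ 3 * |a| ≤ t ^ 3 * (6 * K * t) := by
      have e : t ^ 3 * (6 * K * t) = 6 * (t ^ 4 + t ^ 4 * |b| + t ^ 4 * |c|) := by
        simp only [K]; ring
      rw [e]
      rcases abs_cases a with ⟨ha, _⟩ | ⟨ha, _⟩ <;> rw [ha] <;> nlinarith
    exact le_of_mul_le_mul_left this t3
  by_contra hne
  have ha : 0 < |a| := abs_pos.2 hne
  have hK : 0 < K := by positivity
  have := bound (min 1 (|a| / (12 * K))) (by positivity) (min_le_left _ _)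
  have h2 : 6 * K * min 1 (|a| / (12 * K)) ≤ 6 * K * (|a| / (12 * K)) := by
    gcongr
    exact min_le_right _ _
  have h3 : 6 * K * (|a| / (12 * K)) = |a| / 2 := by field_simp; norm_num
  linarith

/-- Adding `taylor_le` at `t` and at `-t` cancels the odd moments. -/
theorem fourth_moment_le [IsProbabilityMeasure μ] (h : IsStrictlySubGaussian X 1 μ) :
    ∫ ω, X ω ^ 4 ∂μ ≤ 3 := by
  set b := ∫ ω, X ω ^ 4 ∂μ
  have bound : ∀ t : ℝ, 0 < t → t ≤ 1 → b ≤ 3 + t := by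
    intro t ht ht1
    have h1 := h.taylor_le (t := t) (by rw [abs_of_pos ht]; exact ht1)
    have h2 := h.taylor_le (t := -t) (by rw [abs_neg, abs_of_pos ht]; exact ht1)
    change t ^ 3 / 6 * _ + t ^ 4 / 24 * b + _ ≤ _ at h1
    change _ + (-t) ^ 4 / 24 * b + _ ≤ _ at h2
    have l7 : t ^ 6 ≤ t ^ 5 := pow_le_pow_of_le_one ht.le ht1 (by norm_num)
    have l8 : 0 < t ^ 5 := pow_pos ht 5
    have : t ^ 4 * b ≤ t ^ 4 * (3 + t) := by nlinarith
    exact le_of_mul_le_mul_left this (by positivity)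
  refine le_of_forall_pos_le_add fun ε hε =>
    (bound (min 1 ε) (by positivity) (min_le_left _ _)).trans ?_
  linarith [min_le_right 1 ε]

/-- A quadratic majorant of `exp (-(l y))`, taken at `y = (X - s)²`, reduces a Gaussian weight to
the moments of `X` of order at most four. -/
theorem integral_exp_neg_sq_le [IsProbabilityMeasure μ] (h : IsStrictlySubGaussian X 1 μ)
    {l b d : ℝ} (hl : 0 ≤ l) (hd : 0 ≤ d)
    (hq : ∀ y : ℝ, 0 ≤ y → Real.exp (-(l * y)) ≤ 1 - b * y + d * y ^ 2) (s : ℝ) :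
    ∫ ω, Real.exp (-(l * (X ω - s) ^ 2)) ∂μ
      ≤ 1 - b * (1 + s ^ 2) + d * (3 + 6 * s ^ 2 + s ^ 4) := by
  have hX : AEMeasurable X μ := h.mgf_bound.aemeasurable
  have key : ∫ ω, Real.exp (-(l * (X ω - s) ^ 2)) ∂μ ≤
      ∫ ω, ∑ i, (![1 - b * s^2 + d * s^4, 2*b*s - 4*d*s^3, 6*d*s^2 - b, -4*d*s, d] : Fin 5 → ℝ) i
        * X ω ^ (i : ℕ) ∂μ := by
    refine integral_mono ?_ (h.integrable_sum_pow _) fun ω => ?_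
    · refine Integrable.mono' (integrable_const 1) ?_ (ae_of_all _ fun ω => ?_)
      · exact AEMeasurable.aestronglyMeasurable (by fun_prop)
      · rw [Real.norm_eq_abs, abs_of_pos (Real.exp_pos _)]
        apply Real.exp_le_one_iff.2
        have := mul_nonneg hl (sq_nonneg (X ω - s))
        linarith
    · refine (hq ((X ω - s)^2) (sq_nonneg _)).trans (le_of_eq ?_)
      simp [Fin.sum_univ_succ]
      ring
  rw [h.integral_sum_pow] at key
  simp [Fin.sum_univ_succ, h.mean_eq_zero, h.second_moment, h.third_moment] at key
  nlinarith [h.fourth_moment_le]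

theorem integrable_exp_neg_sq (h : IsStrictlySubGaussian X 1 μ) {l : ℝ} (hl : 0 ≤ l) (u : ℝ) :
    Integrable (fun ω => Real.exp (-(l * X ω ^ 2) + u * X ω)) μ := by
  have hX : AEMeasurable X μ := h.mgf_bound.aemeasurable
  refine Integrable.mono' (h.mgf_bound.integrable_exp_mul u)
    (AEMeasurable.aestronglyMeasurable (by fun_prop)) (ae_of_all _ fun ω => ?_)
  rw [Real.norm_eq_abs, abs_of_pos (Real.exp_pos _)]
  apply Real.exp_le_exp.2
  have := mul_nonneg hl (sq_nonneg (X ω))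
  linarith

/-- The scalar estimate behind all lower bounds for distances. For a standard Gaussian variable the
left-hand side is `exp (-log (9/5) / 2 + (5/18) u²)`, where `log (9/5) / 2 ≈ 0.294`. -/
theorem integral_exp_neg_sq_add_le [IsProbabilityMeasure μ] (h : IsStrictlySubGaussian X 1 μ)
    (u : ℝ) :
    ∫ ω, Real.exp (-(2/5 * X ω ^ 2) + u * X ω) ∂μ ≤ Real.exp (-0.263 + u ^ 2 / 2) := by
  by_cases hu : u ^ 2 ≤ 0.96
  · -- complete the square and use a quadratic majorant
    have e : ∀ ω, Real.exp (-(2/5 * X ω ^ 2) + u * X ω) =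
        Real.exp (5/8 * u^2) * Real.exp (-(2/5 * (X ω - 5/4 * u)^2)) := by
      intro ω; rw [← Real.exp_add]; congr 1; ring
    simp_rw [e, integral_const_mul]
    have h1 := h.integral_exp_neg_sq_le (l := 2/5) (b := 69/200) (d := 3/80) (by norm_num)
      (by norm_num)
      (fun y hy => by
        have := exp_neg_le_quadratic_near (u := 2/5 * y) (by positivity)
        refine this.trans (le_of_eq ?_); ring) (5/4 * u)
    have h2 : Real.exp (-0.263 + u^2/2) = Real.exp (5/8 * u^2) * Real.exp (-0.263 - u^2/8) := by
      rw [← Real.exp_add]; congr 1; ring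
    rw [h2]
    refine mul_le_mul_of_nonneg_left (h1.trans ?_) (Real.exp_pos _).le
    have h3 : Real.exp (-0.263 - u^2/8) = Real.exp (-0.263) * Real.exp (-(u^2/8)) := by
      rw [← Real.exp_add]; congr 1
    have h4 : (0.7687:ℝ) ≤ Real.exp (-0.263) := by
      rw [Real.exp_neg, le_inv_comm₀ (by norm_num) (Real.exp_pos _)]
      have := Real.exp_bound' (x := 0.263) (by norm_num) (by norm_num) (n := 5) (by norm_num)
      refine this.trans ?_
      norm_num [Finset.sum_range_succ, Nat.factorial]
    have h5 : 1 - u^2/8 ≤ Real.exp (-(u^2/8)) := by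
      have := Real.add_one_le_exp (-(u^2/8)); linarith
    have h6 : 0.7687 * (1 - u^2/8) ≤ Real.exp (-0.263) * Real.exp (-(u^2/8)) :=
      mul_le_mul h4 h5 (by linarith) (Real.exp_pos _).le
    rw [h3]
    refine le_trans ?_ h6
    have : u ^ 4 = (u^2)^2 := by ring
    nlinarith [sq_nonneg u]
  · -- by the inequality of arithmetic and geometric means, the weight `exp (-(2/5) X²)` is
    -- reduced to the weights `exp (-(4/5) X²)` and `1`
    have hA : ∫ ω, Real.exp (-(4/5 * X ω ^ 2) + u * X ω) ∂μ ≤ Real.exp (-0.526 + u^2/2) := by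
      have e : ∀ ω, Real.exp (-(4/5 * X ω ^ 2) + u * X ω) =
          Real.exp (5/16 * u^2) * Real.exp (-(4/5 * (X ω - 5/8 * u)^2)) := by
        intro ω; rw [← Real.exp_add]; congr 1; ring
      simp_rw [e, integral_const_mul]
      have h2 : Real.exp (-0.526 + u^2/2) =
          Real.exp (5/16 * u^2) * Real.exp (-0.526 + 3/16 * u^2) := by
        rw [← Real.exp_add]; congr 1; ring
      rw [h2]
      refine mul_le_mul_of_nonneg_left ?_ (Real.exp_pos _).le
      by_cases hu2 : u ^ 2 ≤ 3
      · have h1 := h.integral_exp_neg_sq_le (l := 4/5) (b := 11/25) (d := 13/250) (by norm_num)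
          (by norm_num) (fun y hy => by
            have := exp_neg_le_quadratic_far (u := 4/5 * y) (by positivity)
            refine this.trans (le_of_eq ?_); ring) (5/8 * u)
        have h3 : Real.exp (-0.346) ≤ Real.exp (-0.526 + 3/16 * u^2) := by
          apply Real.exp_le_exp.2; linarith
        have h4 : (0.7:ℝ) ≤ Real.exp (-0.346) := by
          rw [Real.exp_neg, le_inv_comm₀ (by norm_num) (Real.exp_pos _)]
          have := Real.exp_bound' (x := 0.346) (by norm_num) (by norm_num) (n := 5) (by norm_num)
          refine this.trans ?_
          norm_num [Finset.sum_range_succ, Nat.factorial]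
        refine h1.trans (le_trans ?_ (h4.trans h3))
        have : u ^ 4 = (u^2)^2 := by ring
        nlinarith [sq_nonneg u]
      · have h1 : (1:ℝ) ≤ Real.exp (-0.526 + 3/16 * u^2) := by
          apply Real.one_le_exp; linarith
        refine le_trans ?_ h1
        have := integral_mono_of_nonneg (μ := μ)
          (f := fun ω => Real.exp (-(4/5 * (X ω - 5/8 * u)^2))) (g := fun _ => 1)
            (ae_of_all _ fun ω => (Real.exp_pos _).le) (integrable_const 1)
          (ae_of_all _ fun ω => Real.exp_le_one_iff.2 (by nlinarith [sq_nonneg (X ω - 5/8 * u)]))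
        simpa using this
    have hB := h.integral_exp_le u
    have iA := h.integrable_exp_neg_sq (l := 4/5) (by norm_num) u
    have iB := h.mgf_bound.integrable_exp_mul u
    have key : ∫ ω, Real.exp (-(2/5 * X ω ^ 2) + u * X ω) ∂μ ≤
        ∫ ω, (Real.exp 0.263 / 2 * Real.exp (-(4/5 * X ω ^ 2) + u * X ω)
          + Real.exp (-0.263) / 2 * Real.exp (u * X ω)) ∂μ := by
      refine integral_mono (h.integrable_exp_neg_sq (by norm_num) u)
        ((iA.const_mul _).add (iB.const_mul _)) fun ω => ?_
      set p := Real.exp ((0.263 + (-(4/5 * X ω ^ 2) + u * X ω)) / 2)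
      set q := Real.exp ((-0.263 + u * X ω) / 2)
      have e1 : Real.exp 0.263 * Real.exp (-(4/5 * X ω ^ 2) + u * X ω) = p ^ 2 := by
        rw [← Real.exp_add, ← Real.exp_nat_mul]; congr 1; push_cast; ring
      have e2 : Real.exp (-0.263) * Real.exp (u * X ω) = q ^ 2 := by
        rw [← Real.exp_add, ← Real.exp_nat_mul]; congr 1; push_cast; ring
      have e3 : Real.exp (-(2/5 * X ω ^ 2) + u * X ω) = p * q := by
        rw [← Real.exp_add]; congr 1; ring
      change Real.exp (-(2/5 * X ω ^ 2) + u * X ω) ≤ _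
      rw [e3]
      refine le_trans (b := (p ^ 2 + q ^ 2) / 2) (by linarith [two_mul_le_add_sq p q]) (le_of_eq ?_)
      rw [← e1, ← e2]
      ring
    rw [integral_add (iA.const_mul _) (iB.const_mul _), integral_const_mul,
      integral_const_mul] at key
    have e1 : Real.exp 0.263 * Real.exp (-0.526 + u^2/2) = Real.exp (-0.263 + u^2/2) := by
      rw [← Real.exp_add]; congr 1; ring
    have e2 : Real.exp (-0.263) * Real.exp (u^2/2) = Real.exp (-0.263 + u^2/2) := by
      rw [← Real.exp_add]
    have p1 := mul_le_mul_of_nonneg_left hA (Real.exp_pos 0.263).le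
    have p2 := mul_le_mul_of_nonneg_left hB (Real.exp_pos (-0.263)).le
    rw [e1] at p1
    rw [e2] at p2
    linarith

end IsStrictlySubGaussian

/-! ### Independence and standard families of random vectors -/

/-- The rows of an array of jointly independent variables are independent. -/
theorem ProbabilityTheory.iIndepFun.curry {Ω ι κ 𝓧 : Type*} [MeasurableSpace Ω]
    [MeasurableSpace 𝓧] {μ : Measure Ω} {X : ι → κ → Ω → 𝓧} (hX : ∀ i j, Measurable (X i j))
    (h : iIndepFun (fun (p : ι × κ) ω => X p.1 p.2 ω) μ) :
    iIndepFun (fun i ω j => X i j ω) μ := by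
  have := h.isProbabilityMeasure
  have : ∀ i j, IsProbabilityMeasure (μ.map (X i j)) :=
    fun i j => Measure.isProbabilityMeasure_map (hX i j).aemeasurable
  have hrow (i : ι) : iIndepFun (X i) μ :=
    h.precomp (g := fun j => (i, j)) (fun _ _ hjk => (Prod.mk.inj hjk).2)
  have e : (MeasurableEquiv.curry ι κ 𝓧) ∘ (fun ω p => X p.1 p.2 ω) = fun ω i j => X i j ω := by
    ext; simp
  rw [iIndepFun_iff_map_fun_eq_infinitePi_map (by fun_prop)] at h ⊢
  rw [← e, ← Measure.map_map (by fun_prop) (by fun_prop), h,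
    Measure.infinitePi_map_curry (fun i j => μ.map (X i j))]
  congrm Measure.infinitePi fun i => ?_
  exact ((iIndepFun_iff_map_fun_eq_infinitePi_map (by fun_prop)).1 (hrow i)).symm

/-- A bound that holds conditionally on every value of `X` may be integrated over `X`. No
measurability of `g` is needed. -/
theorem ProbabilityTheory.IndepFun.lintegral_le {Ω α β : Type*} [MeasurableSpace Ω]
    [MeasurableSpace α] [MeasurableSpace β] {μ : Measure Ω} [IsProbabilityMeasure μ]
    {X : Ω → α} {Y : Ω → β} (hX : Measurable X) (hY : Measurable Y) (h : IndepFun X Y μ)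
    {f : α → β → ℝ≥0∞} (hf : Measurable (Function.uncurry f)) {g : α → ℝ≥0∞}
    (hfg : ∀ x, ∫⁻ ω, f x (Y ω) ∂μ ≤ g x) :
    ∫⁻ ω, f (X ω) (Y ω) ∂μ ≤ ∫⁻ ω, g (X ω) ∂μ := by
  have h1 := (indepFun_iff_map_prod_eq_prod_map_map hX.aemeasurable hY.aemeasurable).1 h
  have : IsProbabilityMeasure (μ.map Y) := Measure.isProbabilityMeasure_map hY.aemeasurable
  have h2 : ∫⁻ ω, f (X ω) (Y ω) ∂μ =
      ∫⁻ p, Function.uncurry f p ∂(μ.map fun ω => (X ω, Y ω)) := by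
    rw [lintegral_map hf (hX.prodMk hY)]; rfl
  rw [h2, h1, lintegral_prod _ hf.aemeasurable]
  have hm : Measurable fun x => ∫⁻ y, Function.uncurry f (x, y) ∂(μ.map Y) :=
    hf.lintegral_prod_right'
  rw [lintegral_map hm hX]
  refine lintegral_mono fun ω => ?_
  have hs : Measurable fun y => Function.uncurry f (X ω, y) := hf.comp measurable_prodMk_left
  rw [lintegral_map hs hY]
  exact hfg _

section Families
variable {Ω ι κ : Type*} [MeasurableSpace Ω] {μ : Measure Ω}

/-- A random vector whose coordinates are independent and strictly sub-Gaussian with variance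
one. -/
structure IsStdVector (z : Ω → EuclideanSpace ℝ ι) (μ : Measure Ω) : Prop where
  measurable : Measurable z
  indep : iIndepFun (fun i ω => z ω i) μ
  subGaussian : ∀ i, IsStrictlySubGaussian (fun ω => z ω i) 1 μ

/-- A family of random vectors all of whose coordinates are jointly independent and strictly
sub-Gaussian with variance one. -/
structure IsStdFamily (a : κ → Ω → EuclideanSpace ℝ ι) (μ : Measure Ω) : Prop where
  measurable : ∀ j, Measurable (a j)
  indep : iIndepFun (fun (p : κ × ι) ω => a p.1 ω p.2) μ
  subGaussian : ∀ j i, IsStrictlySubGaussian (fun ω => a j ω i) 1 μ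

namespace IsStdFamily
variable {a : κ → Ω → EuclideanSpace ℝ ι}

theorem isStdVector (h : IsStdFamily a μ) (j : κ) : IsStdVector (a j) μ where
  measurable := h.measurable j
  indep := h.indep.precomp (g := fun i => (j, i)) (fun _ _ hjk => (Prod.mk.inj hjk).2)
  subGaussian := h.subGaussian j

theorem measurable_entry (h : IsStdFamily a μ) (j : κ) (i : ι) : Measurable fun ω => a j ω i := by
  have := h.measurable j
  fun_prop

theorem iIndepFun_columns (h : IsStdFamily a μ) : iIndepFun a μ := by
  have h1 := iIndepFun.curry (X := fun j i ω => a j ω i) h.measurable_entry h.indep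
  exact h1.comp (fun _ x => WithLp.toLp 2 x) (fun _ => by fun_prop)

/-- A linear combination, with coefficients of Euclidean norm one, of the members of a standard
family is a standard vector. -/
theorem isStdVector_sum [Fintype ι] [IsProbabilityMeasure μ] (h : IsStdFamily a μ) (S : Finset κ)
    (c : κ → ℝ) (hc : ∑ j ∈ S, c j ^ 2 = 1) : IsStdVector (fun ω => ∑ j ∈ S, c j • a j ω) μ where
  measurable := by
    have := h.measurable
    fun_prop
  indep := by
    have h1 : iIndepFun (fun (p : ι × κ) ω => a p.2 ω p.1) μ :=
      h.indep.precomp (g := Prod.swap) Prod.swap_injective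
    have h2 := iIndepFun.curry (X := fun i j ω => a j ω i) (fun i j => h.measurable_entry j i) h1
    have h3 := h2.comp (fun _ x => ∑ j ∈ S, c j * x j) (fun _ => by fun_prop)
    convert h3 using 2 with i
    ext ω
    simp
  subGaussian i := by
    have e : (fun ω => (∑ j ∈ S, c j • a j ω) i) = fun ω => ∑ j ∈ S, c j * a j ω i := by
      ext ω; simp
    classical
    rw [e]
    have hind : iIndepFun (fun j ω => a j ω i) μ :=
      h.indep.precomp (g := fun j => (j, i)) (fun _ _ hjk => (Prod.mk.inj hjk).1)
    have hind' : iIndepFun (fun j ω => c j * a j ω i) μ :=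
      hind.comp (fun j x => c j * x) (fun _ => by fun_prop)
    have hint (j : κ) : Integrable (fun ω => a j ω i) μ := (h.subGaussian j i).mgf_bound.integrable
    refine ⟨?_, ?_, ?_⟩
    · rw [integral_finsetSum _ fun j _ => (hint j).const_mul _]
      simp [integral_const_mul, (h.subGaussian _ i).mean_eq_zero]
    · have hmul (j l : κ) : Integrable (fun ω => a j ω i * a l ω i) μ :=
        MemLp.integrable_mul (p := 2) (q := 2) ((h.subGaussian j i).mgf_bound.memLp 2)
          ((h.subGaussian l i).mgf_bound.memLp 2)
      have hval (j l : κ) : ∫ ω, a j ω i * a l ω i ∂μ = if j = l then 1 else 0 := by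
        split_ifs with hjl
        · subst hjl
          have := (h.subGaussian j i).second_moment
          simpa [sq] using this
        · have := (hind.indepFun hjl).integral_fun_mul_eq_mul_integral
            (h.measurable_entry j i).aestronglyMeasurable
            (h.measurable_entry l i).aestronglyMeasurable
          rw [this, (h.subGaussian j i).mean_eq_zero, zero_mul]
      have e2 : ∀ ω, (∑ j ∈ S, c j * a j ω i) ^ 2 =
          ∑ j ∈ S, ∑ l ∈ S, (c j * c l) * (a j ω i * a l ω i) := by
        intro ω
        rw [sq, Finset.sum_mul_sum]
        refine Finset.sum_congr rfl fun j _ => Finset.sum_congr rfl fun l _ => by ring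
      simp_rw [e2]
      rw [integral_finsetSum _ fun j _ => integrable_finsetSum _ fun l _ => (hmul j l).const_mul _]
      have e3 : ∀ j ∈ S, ∫ ω, ∑ l ∈ S, (c j * c l) * (a j ω i * a l ω i) ∂μ = c j ^ 2 := by
        intro j hj
        rw [integral_finsetSum _ fun l _ => (hmul j l).const_mul _]
        simp [integral_const_mul, hval, hj, sq]
      rw [Finset.sum_congr rfl e3, hc]
      simp
    · have h5 := HasSubgaussianMGF.sum_of_iIndepFun hind' (s := S)
        (c := fun j => (c j ^ 2).toNNReal) (fun j _ => by
          have h6 := (h.subGaussian j i).mgf_bound.const_mul (c j)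
          convert h6 using 1
          exact (Real.toNNReal_of_nonneg (sq_nonneg _)).trans (mul_one _).symm)
      have e4 : ∑ j ∈ S, (c j ^ 2).toNNReal = 1 := by
        rw [← Real.toNNReal_sum_of_nonneg fun _ _ => sq_nonneg _, hc, Real.toNNReal_one]
      rwa [e4] at h5

end IsStdFamily

namespace IsStdVector
variable {z : Ω → EuclideanSpace ℝ ι}

theorem measurable_coord (h : IsStdVector z μ) (i : ι) : Measurable fun ω => z ω i := by
  have := h.measurable
  fun_prop

theorem lintegral_ofReal_exp_sum_le [Fintype ι] (h : IsStdVector z μ) (f : ι → ℝ → ℝ)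
    (hf : ∀ i, Measurable (f i)) (c : ι → ℝ)
    (hint : ∀ i, Integrable (fun ω => Real.exp (f i (z ω i))) μ)
    (hle : ∀ i, ∫ ω, Real.exp (f i (z ω i)) ∂μ ≤ Real.exp (c i)) :
    ∫⁻ ω, ENNReal.ofReal (Real.exp (∑ i, f i (z ω i))) ∂μ ≤
      ENNReal.ofReal (Real.exp (∑ i, c i)) := by
  have e : ∀ ω, ENNReal.ofReal (Real.exp (∑ i, f i (z ω i))) =
      ∏ i, ENNReal.ofReal (Real.exp (f i (z ω i))) := fun ω => by
    rw [Real.exp_sum, ENNReal.ofReal_prod_of_nonneg fun _ _ => (Real.exp_pos _).le]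
  simp_rw [e]
  have hm (i : ι) : Measurable fun x => ENNReal.ofReal (Real.exp (f i x)) := by
    have := hf i
    fun_prop
  rw [lintegral_prod_eq_prod_lintegral_of_indepFun Finset.univ
    (fun i ω => ENNReal.ofReal (Real.exp (f i (z ω i)))) (h.indep.comp _ hm)
    (fun i => (hm i).comp (h.measurable_coord i)), Real.exp_sum,
    ENNReal.ofReal_prod_of_nonneg fun _ _ => (Real.exp_pos _).le]
  refine Finset.prod_le_prod' fun i _ => ?_
  rw [← ofReal_integral_eq_lintegral_ofReal (hint i) (ae_of_all _ fun _ => (Real.exp_pos _).le)]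
  exact ENNReal.ofReal_le_ofReal (hle i)

theorem lintegral_exp_inner_le [Fintype ι] (h : IsStdVector z μ) (u : EuclideanSpace ℝ ι) :
    ∫⁻ ω, ENNReal.ofReal (Real.exp (inner ℝ u (z ω))) ∂μ ≤
      ENNReal.ofReal (Real.exp (‖u‖ ^ 2 / 2)) := by
  have := h.lintegral_ofReal_exp_sum_le (fun i x => u i * x) (fun i => by fun_prop)
    (fun i => u i ^ 2 / 2) (fun i => (h.subGaussian i).mgf_bound.integrable_exp_mul (u i))
    (fun i => (h.subGaussian i).integral_exp_le (u i))
  rw [EuclideanSpace.real_norm_sq_eq, Finset.sum_div]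
  convert this using 6
  simp [PiLp.inner_apply, mul_comm]

theorem lintegral_exp_neg_norm_sq_add_inner_le [Fintype ι] [IsProbabilityMeasure μ]
    (h : IsStdVector z μ) (u : EuclideanSpace ℝ ι) :
    ∫⁻ ω, ENNReal.ofReal (Real.exp (-(2 / 5 * ‖z ω‖ ^ 2) + inner ℝ u (z ω))) ∂μ ≤
      ENNReal.ofReal (Real.exp (-0.263 * Fintype.card ι)) *
        ENNReal.ofReal (Real.exp (‖u‖ ^ 2 / 2)) := by
  have := h.lintegral_ofReal_exp_sum_le (fun i x => -(2 / 5 * x ^ 2) + u i * x)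
    (fun i => by fun_prop) (fun i => -0.263 + u i ^ 2 / 2)
    (fun i => (h.subGaussian i).integrable_exp_neg_sq (by norm_num) (u i))
    (fun i => (h.subGaussian i).integral_exp_neg_sq_add_le (u i))
  rw [← ENNReal.ofReal_mul (Real.exp_pos _).le, ← Real.exp_add]
  convert this using 4 with ω
  · rw [Finset.sum_add_distrib, EuclideanSpace.real_norm_sq_eq, Finset.sum_neg_distrib,
      Finset.mul_sum]
    simp [PiLp.inner_apply, mul_comm]
  · rw [EuclideanSpace.real_norm_sq_eq, Finset.sum_add_distrib, Finset.sum_div]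
    simp; ring

end IsStdVector
end Families

/-! ### Gaussian linearization -/

namespace ProbabilityTheory

theorem lintegral_gaussianReal_exp_mul (t : ℝ) :
    ∫⁻ x, ENNReal.ofReal (Real.exp (t * x)) ∂(gaussianReal 0 1) =
      ENNReal.ofReal (Real.exp (t ^ 2 / 2)) := by
  rw [← ofReal_integral_eq_lintegral_ofReal (integrable_exp_mul_gaussianReal t)
    (ae_of_all _ fun _ => (Real.exp_pos _).le)]
  have := mgf_gaussianReal (p := gaussianReal 0 1) (X := id) (μ := 0) (v := 1) (by simp) t
  simp [mgf] at this
  rw [this]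

theorem lintegral_gaussianReal_exp_mul_sq {q : ℝ} (hq : q < 1 / 2) :
    ∫⁻ x, ENNReal.ofReal (Real.exp (q * x ^ 2)) ∂(gaussianReal 0 1) =
      ENNReal.ofReal (√(1 - 2 * q))⁻¹ := by
  rw [gaussianReal_of_var_ne_zero _ one_ne_zero,
    lintegral_withDensity_eq_lintegral_mul _ (measurable_gaussianPDF 0 1) (by fun_prop)]
  have hq' : 0 < 1 / 2 - q := by linarith
  have e : ∀ x, (gaussianPDF 0 1 * fun x => ENNReal.ofReal (Real.exp (q * x ^ 2))) x =
      ENNReal.ofReal ((√(2 * Real.pi))⁻¹ * Real.exp (-(1 / 2 - q) * x ^ 2)) := by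
    intro x
    rw [Pi.mul_apply, gaussianPDF, ← ENNReal.ofReal_mul (gaussianPDFReal_nonneg _ _ _),
      gaussianPDFReal, mul_assoc, ← Real.exp_add]
    simp only [NNReal.coe_one, mul_one, sub_zero]
    congr 3; ring
  simp_rw [e]
  rw [← ofReal_integral_eq_lintegral_ofReal ((integrable_exp_neg_mul_sq hq').const_mul _)
    (ae_of_all _ fun _ => by positivity), integral_const_mul, integral_gaussian]
  congr 1
  rw [← Real.sqrt_inv, ← Real.sqrt_mul (by positivity), ← Real.sqrt_inv]
  congr 1
  have : (1 - 2 * q) ≠ 0 := by linarith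
  have h2 : (1 / 2 - q) ≠ 0 := by linarith
  have h3 : (1 - 2 * q) = 2 * (1 / 2 - q) := by ring
  have := Real.pi_pos.ne'
  rw [h3]
  field_simp

theorem lintegral_pi_gaussianReal_prod {σ : Type*} [Fintype σ] (f : σ → ℝ → ℝ)
    (hf : ∀ j, Measurable (f j)) :
    ∫⁻ g : σ → ℝ, ENNReal.ofReal (Real.exp (∑ j, f j (g j)))
        ∂(Measure.pi fun _ => gaussianReal 0 1) =
          ∏ j, ∫⁻ x, ENNReal.ofReal (Real.exp (f j x)) ∂(gaussianReal 0 1) := by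
  have hm (j : σ) : Measurable fun x => ENNReal.ofReal (Real.exp (f j x)) := by
    have := hf j
    fun_prop
  have hi : iIndepFun (fun j (g : σ → ℝ) => ENNReal.ofReal (Real.exp (f j (g j))))
      (Measure.pi fun _ => gaussianReal 0 1) := iIndepFun_pi fun j => (hm j).aemeasurable
  have := lintegral_prod_eq_prod_lintegral_of_indepFun Finset.univ _ hi
    fun j => (hm j).comp (measurable_pi_apply j)
  simp_rw [Real.exp_sum, ENNReal.ofReal_prod_of_nonneg fun _ _ => (Real.exp_pos _).le]
  rw [this]
  refine Finset.prod_congr rfl fun j _ => ?_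
  exact (measurePreserving_eval (fun _ : σ => gaussianReal 0 1) j).lintegral_comp (hm j)

/-- If the Laplace transform of `z` is at most `C` times that of a standard Gaussian vector, the
exponential moments of quadratic forms `q ‖R z‖²` with `‖R‖ ≤ 1` are at most `C` times those of
`q ‖g‖²`, with `g` a standard Gaussian vector in the target of `R`: write `exp (q ‖R z‖²)` as the
expectation of `exp (√(2 q) ⟨Rᵀ g, z⟩)` and integrate over `z` first. The rows of `R` are the
vectors `r j`, and `hr` says that its transpose is a contraction. -/
theorem lintegral_exp_mul_sum_inner_sq_le {Ω E σ : Type*} [MeasurableSpace Ω] {ν : Measure Ω}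
    [SFinite ν] [NormedAddCommGroup E] [InnerProductSpace ℝ E] [MeasurableSpace E] [BorelSpace E]
    [SecondCountableTopology E]
    [Fintype σ] {z : Ω → E} (hz : Measurable z) {C : ℝ≥0∞}
    (hν : ∀ u : E, ∫⁻ ω, ENNReal.ofReal (Real.exp (inner ℝ u (z ω))) ∂ν ≤
      C * ENNReal.ofReal (Real.exp (‖u‖ ^ 2 / 2)))
    {r : σ → E} (hr : ∀ g : σ → ℝ, ‖∑ j, g j • r j‖ ^ 2 ≤ ∑ j, g j ^ 2) {q : ℝ} (hq0 : 0 ≤ q)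
    (hq : q < 1 / 2) :
    ∫⁻ ω, ENNReal.ofReal (Real.exp (q * ∑ j, inner ℝ (r j) (z ω) ^ 2)) ∂ν ≤
      C * ENNReal.ofReal ((√(1 - 2 * q))⁻¹ ^ Fintype.card σ) := by
  set γ := Measure.pi fun _ : σ => gaussianReal 0 1
  have e1 : ∀ ω, ENNReal.ofReal (Real.exp (q * ∑ j, inner ℝ (r j) (z ω) ^ 2)) =
      ∫⁻ g, ENNReal.ofReal (Real.exp (inner ℝ (√(2 * q) • ∑ j, g j • r j) (z ω))) ∂γ := by
    intro ω
    have e2 : ∀ g : σ → ℝ, inner ℝ (√(2 * q) • ∑ j, g j • r j) (z ω) =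
        ∑ j, (√(2 * q) * inner ℝ (r j) (z ω)) * g j := by
      intro g
      rw [real_inner_smul_left, sum_inner, Finset.mul_sum]
      refine Finset.sum_congr rfl fun j _ => ?_
      rw [real_inner_smul_left]; ring
    simp_rw [e2]
    rw [lintegral_pi_gaussianReal_prod (fun j x => (√(2 * q) * inner ℝ (r j) (z ω)) * x)
      (fun j => by fun_prop)]
    simp_rw [lintegral_gaussianReal_exp_mul]
    rw [← ENNReal.ofReal_prod_of_nonneg fun _ _ => (Real.exp_pos _).le, ← Real.exp_sum,
      Finset.mul_sum]
    congr 2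
    refine Finset.sum_congr rfl fun j _ => ?_
    rw [mul_pow, Real.sq_sqrt (by positivity)]; ring
  simp_rw [e1]
  rw [lintegral_lintegral_swap
    (Measurable.aemeasurable (by simp only [Function.uncurry_def]; fun_prop))]
  calc _ ≤ ∫⁻ g, C * ENNReal.ofReal (Real.exp (∑ j, q * g j ^ 2)) ∂γ := by
        refine lintegral_mono fun g => (hν _).trans ?_
        gcongr
        rw [norm_smul, mul_pow, Real.norm_eq_abs, sq_abs, Real.sq_sqrt (by positivity),
          ← Finset.mul_sum]
        have := mul_le_mul_of_nonneg_left (hr g) hq0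
        linarith
    _ = C * ENNReal.ofReal ((√(1 - 2 * q))⁻¹ ^ Fintype.card σ) := by
        rw [lintegral_const_mul _ (by fun_prop),
          lintegral_pi_gaussianReal_prod (fun _ x => q * x ^ 2) (fun j => by fun_prop)]
        simp_rw [lintegral_gaussianReal_exp_mul_sq hq]
        rw [Finset.prod_const, Finset.card_univ, ENNReal.ofReal_pow (by positivity)]

end ProbabilityTheory

/-! ### Distances to a fixed subspace -/

section ExpNegDist
variable {E σ : Type*} [NormedAddCommGroup E] [InnerProductSpace ℝ E] [Fintype σ]

/-- `exp (-(2/5) d²)`, where `d` is the distance of `z` to the span of the vectors `x t`. Writing it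
as a supremum of continuous functions makes it lower semicontinuous, hence measurable, jointly in
`z` and `x`. -/
noncomputable def expNegSqDist (z : E) (x : σ → E) : ℝ≥0∞ :=
  ⨆ η : σ → ℝ, ENNReal.ofReal (Real.exp (-(2 / 5 * ‖z + ∑ t, η t • x t‖ ^ 2)))

theorem measurable_expNegSqDist [MeasurableSpace E] [BorelSpace E] [SecondCountableTopology E] :
    Measurable fun p : E × (σ → E) => expNegSqDist p.1 p.2 := by
  refine LowerSemicontinuous.measurable (lowerSemicontinuous_iSup fun η => ?_)
  refine Continuous.lowerSemicontinuous ?_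
  refine ENNReal.continuous_ofReal.comp ?_
  fun_prop

theorem Measurable.expNegSqDist [MeasurableSpace E] [BorelSpace E] [SecondCountableTopology E]
    {α : Type*} [MeasurableSpace α] {f : α → E} {g : α → σ → E} (hf : Measurable f)
    (hg : Measurable g) : Measurable fun x => _root_.expNegSqDist (f x) (g x) := by
  have h1 : Measurable fun x => (f x, g x) := hf.prodMk hg
  have h2 := Measurable.comp (measurable_expNegSqDist (E := E) (σ := σ)) h1
  exact h2

theorem expNegSqDist_eq_one_of_mem_span {z : E} {x : σ → E}
    (h : z ∈ Submodule.span ℝ (Set.range x)) : expNegSqDist z x = 1 := by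
  refine le_antisymm (iSup_le fun η => ?_) ?_
  · rw [← ENNReal.ofReal_one]
    refine ENNReal.ofReal_le_ofReal (Real.exp_le_one_iff.2 ?_)
    have := sq_nonneg ‖z + ∑ t, η t • x t‖
    linarith
  · obtain ⟨η, rfl⟩ := (Submodule.mem_span_range_iff_exists_fun ℝ).1 h
    refine le_iSup_of_le (-η) ?_
    simp

/-- The vectors `r j` form an orthonormal basis of the span of the `x t`; the exponent on the right
is `-(2/5)` times the squared distance to that span. -/
theorem exists_orthonormal_expNegSqDist_le (x : σ → E) :
    ∃ (d : ℕ) (r : Fin d → E), d ≤ Fintype.card σ ∧ Orthonormal ℝ r ∧ ∀ z,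
      expNegSqDist z x ≤
        ENNReal.ofReal (Real.exp (-(2 / 5 * ‖z‖ ^ 2) + 2 / 5 * ∑ j, inner ℝ (r j) z ^ 2)) := by
  set W := Submodule.span ℝ (Set.range x)
  have : FiniteDimensional ℝ W := FiniteDimensional.span_of_finite ℝ (Set.finite_range x)
  set b := stdOrthonormalBasis ℝ W
  refine ⟨_, fun j => (b j : E), finrank_range_le_card x,
    b.orthonormal.comp_linearIsometry W.subtypeₗᵢ, fun z => iSup_le fun η => ?_⟩
  refine ENNReal.ofReal_le_ofReal (Real.exp_le_exp.2 ?_)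
  have hw : ∑ t, η t • x t ∈ W :=
    Submodule.sum_mem _ fun t _ => Submodule.smul_mem _ _ (Submodule.subset_span ⟨t, rfl⟩)
  set w : W := ⟨_, hw⟩
  have e1 : ‖(w : E)‖ ^ 2 = ∑ j, inner ℝ (b j : E) (w : E) ^ 2 := by
    have h := b.sum_sq_norm_inner_right w
    simp only [Real.norm_eq_abs, sq_abs, Submodule.coe_inner] at h
    exact h.symm
  have e2 : inner ℝ z (w : E) = ∑ j, inner ℝ (b j : E) (w : E) * inner ℝ (b j : E) z := by
    have h := congrArg (Subtype.val) (b.sum_repr' w)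
    rw [Submodule.coe_sum] at h
    conv_lhs => rw [← h]
    rw [inner_sum]
    refine Finset.sum_congr rfl fun j _ => ?_
    rw [Submodule.coe_smul, real_inner_smul_right, Submodule.coe_inner, real_inner_comm z]
  have e3 : 0 ≤ ∑ j, (inner ℝ (b j : E) z + inner ℝ (b j : E) (w : E)) ^ 2 :=
    Finset.sum_nonneg fun _ _ => sq_nonneg _
  have e4 : ∑ j, (inner ℝ (b j : E) z + inner ℝ (b j : E) (w : E)) ^ 2 =
      ∑ j, inner ℝ (b j : E) z ^ 2 + 2 * inner ℝ z (w : E) + ‖(w : E)‖ ^ 2 := by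
    rw [e1, e2, Finset.mul_sum, ← Finset.sum_add_distrib, ← Finset.sum_add_distrib]
    exact Finset.sum_congr rfl fun j _ => by ring
  have e5 := norm_add_sq_real z (w : E)
  change -(2 / 5 * ‖z + (w : E)‖ ^ 2) ≤ _
  linarith

end ExpNegDist

namespace IsStdVector
variable {Ω ι σ : Type*} [MeasurableSpace Ω] {μ : Measure Ω} [IsProbabilityMeasure μ] [Fintype ι]
  [Fintype σ] {z : Ω → EuclideanSpace ℝ ι}

theorem lintegral_exp_mul_sum_inner_sq_le (h : IsStdVector z μ) {r : σ → EuclideanSpace ℝ ι}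
    (hr : ∀ g : σ → ℝ, ‖∑ j, g j • r j‖ ^ 2 ≤ ∑ j, g j ^ 2) {q : ℝ} (hq0 : 0 ≤ q)
    (hq : q < 1 / 2) :
    ∫⁻ ω, ENNReal.ofReal (Real.exp (q * ∑ j, inner ℝ (r j) (z ω) ^ 2)) ∂μ ≤
      ENNReal.ofReal ((√(1 - 2 * q))⁻¹ ^ Fintype.card σ) := by
  simpa using ProbabilityTheory.lintegral_exp_mul_sum_inner_sq_le (C := 1) h.measurable
    (by simpa using h.lintegral_exp_inner_le) hr hq0 hq

theorem lintegral_exp_mul_norm_sq_le (h : IsStdVector z μ) {q : ℝ} (hq0 : 0 ≤ q)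
    (hq : q < 1 / 2) :
    ∫⁻ ω, ENNReal.ofReal (Real.exp (q * ‖z ω‖ ^ 2)) ∂μ ≤
      ENNReal.ofReal ((√(1 - 2 * q))⁻¹ ^ Fintype.card ι) := by
  classical
  have := h.lintegral_exp_mul_sum_inner_sq_le (r := fun i => EuclideanSpace.single i (1 : ℝ))
    (fun g => by
      rw [EuclideanSpace.real_norm_sq_eq]
      simp [Finset.sum_apply, Pi.single_apply]) hq0 hq
  simpa [EuclideanSpace.real_norm_sq_eq, EuclideanSpace.inner_single_left] using this

/-- The expectation is taken with respect to the measure with density `exp (-(2/5) ‖z‖²)`, for which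
`lintegral_exp_neg_norm_sq_add_inner_le` bounds the Laplace transform, and Gaussian linearization
applies to the projection onto the span of `x`; the factor `√5` is `(1 - 2 * (2/5)) ^ (-1/2)`. -/
theorem lintegral_expNegSqDist_le (h : IsStdVector z μ) (x : σ → EuclideanSpace ℝ ι) :
    ∫⁻ ω, expNegSqDist (z ω) x ∂μ ≤
      ENNReal.ofReal (Real.exp (-0.263 * Fintype.card ι) * √5 ^ Fintype.card σ) := by
  obtain ⟨d, r, hd, hr, hle⟩ := exists_orthonormal_expNegSqDist_le x
  have hz := h.measurable
  set w : Ω → ℝ≥0∞ := fun ω => ENNReal.ofReal (Real.exp (-(2 / 5 * ‖z ω‖ ^ 2)))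
  have hw : Measurable w := by fun_prop
  have key := ProbabilityTheory.lintegral_exp_mul_sum_inner_sq_le (ν := μ.withDensity w)
    h.measurable (C := ENNReal.ofReal (Real.exp (-0.263 * Fintype.card ι)))
      (r := r) (q := 2 / 5) (fun u => by
      rw [lintegral_withDensity_eq_lintegral_mul _ hw (by fun_prop)]
      refine le_trans (le_of_eq ?_) (h.lintegral_exp_neg_norm_sq_add_inner_le u)
      refine lintegral_congr fun ω => ?_
      rw [Pi.mul_apply, ← ENNReal.ofReal_mul (Real.exp_pos _).le, ← Real.exp_add])
    (fun g => by
      rw [← real_inner_self_eq_norm_sq, hr.inner_sum]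
      simp [sq]) (by norm_num) (by norm_num)
  rw [lintegral_withDensity_eq_lintegral_mul _ hw (by fun_prop)] at key
  calc _ ≤ _ := lintegral_mono fun ω => hle (z ω)
    _ = _ := by
      refine lintegral_congr fun ω => ?_
      rw [Real.exp_add, ENNReal.ofReal_mul (Real.exp_pos _).le]
      rfl
    _ ≤ _ := key
    _ ≤ _ := by
      rw [← ENNReal.ofReal_mul (Real.exp_pos _).le]
      refine ENNReal.ofReal_le_ofReal (mul_le_mul_of_nonneg_left ?_ (Real.exp_pos _).le)
      have h5 : (√(1 - 2 * (2 / 5)))⁻¹ = √5 := by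
        rw [← Real.sqrt_inv]; norm_num
      rw [h5, Fintype.card_fin]
      exact pow_le_pow_right₀ (by rw [Real.one_le_sqrt]; norm_num) hd

end IsStdVector

/-! ### Nets of the sphere -/

section Net
variable {E : Type*} [NormedAddCommGroup E] [NormedSpace ℝ E] [FiniteDimensional ℝ E]

open scoped Function in
/-- Volume bound: the balls of radius `ε / 2` around the points are disjoint and lie in the ball of
radius `1 + ε / 2`. -/
theorem card_le_of_pairwise_le_norm_sub {ε : ℝ} (hε : 0 < ε) (s : Finset E)
    (hs : ∀ c ∈ s, ‖c‖ ≤ 1) (h : ∀ c ∈ s, ∀ d ∈ s, c ≠ d → ε ≤ ‖c - d‖) :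
    (s.card : ℝ) ≤ (1 + 2 / ε) ^ Module.finrank ℝ E := by
  borelize E
  let ν : Measure E := Measure.addHaar
  have hδ : 0 < ε / 2 := by positivity
  have hρ : 0 < 1 + ε / 2 := by positivity
  have D : Set.Pairwise (s : Set E) (Disjoint on fun c => Metric.ball (c : E) (ε / 2)) := by
    rintro c hc d hd hcd
    apply Metric.ball_disjoint_ball
    rw [dist_eq_norm, add_halves]
    exact h c hc d hd hcd
  have A_subset : (⋃ c ∈ s, Metric.ball (c : E) (ε / 2)) ⊆ Metric.ball (0 : E) (1 + ε / 2) := by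
    refine Set.iUnion₂_subset fun x hx => Metric.ball_subset_ball' ?_
    rw [dist_zero_right]
    linarith [hs x hx]
  have I : (s.card : ℝ≥0∞) * ENNReal.ofReal ((ε / 2) ^ Module.finrank ℝ E) * ν (Metric.ball 0 1) ≤
      ENNReal.ofReal ((1 + ε / 2) ^ Module.finrank ℝ E) * ν (Metric.ball 0 1) := by
    have h1 := measure_mono (μ := ν) A_subset
    rw [measure_biUnion_finset D fun c _ => measurableSet_ball] at h1
    simp only [ν.addHaar_ball_of_pos _ hδ, ν.addHaar_ball_of_pos _ hρ, Finset.sum_const,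
      nsmul_eq_mul] at h1
    rwa [mul_assoc]
  have J := (ENNReal.mul_le_mul_iff_left (Metric.measure_ball_pos _ _ zero_lt_one).ne'
    measure_ball_lt_top.ne).1 I
  have K := ENNReal.toReal_le_of_le_ofReal (by positivity) J
  rw [ENNReal.toReal_mul, ENNReal.toReal_natCast, ENNReal.toReal_ofReal (by positivity),
    ← le_div_iff₀ (by positivity), ← div_pow] at K
  have e : (1 + ε / 2) / (ε / 2) = 1 + 2 / ε := by
    field_simp
    ring
  rwa [e] at K

/-- A separated subset of the sphere of maximal cardinality is a net. -/
theorem exists_finset_sphere_net {ε : ℝ} (hε : 0 < ε) :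
    ∃ N : Finset E, (∀ c ∈ N, ‖c‖ = 1) ∧ (N.card : ℝ) ≤ (1 + 2 / ε) ^ Module.finrank ℝ E ∧
      ∀ v : E, ‖v‖ = 1 → ∃ c ∈ N, ‖v - c‖ < ε := by
  classical
  let P : Set ℕ := {p | ∃ s : Finset E, s.card = p ∧ (∀ c ∈ s, ‖c‖ = 1) ∧
    ∀ c ∈ s, ∀ d ∈ s, c ≠ d → ε ≤ ‖c - d‖}
  have hne : P.Nonempty := ⟨0, ∅, by simp⟩
  have hbdd : BddAbove P := by
    refine ⟨⌈(1 + 2 / ε) ^ Module.finrank ℝ E⌉₊, ?_⟩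
    rintro _ ⟨s, rfl, h1, h2⟩
    have := card_le_of_pairwise_le_norm_sub hε s (fun c hc => (h1 c hc).le) h2
    exact_mod_cast this.trans (Nat.le_ceil _)
  obtain ⟨N, hN, h1, h2⟩ := Nat.sSup_mem hne hbdd
  refine ⟨N, h1, card_le_of_pairwise_le_norm_sub hε N (fun c hc => (h1 c hc).le) h2,
    fun v hv => ?_⟩
  by_contra! hfar
  have hvN : v ∉ N := fun hvN => by
    have := hfar v hvN
    rw [sub_self, norm_zero] at this
    linarith
  have hmem : N.card + 1 ∈ P := by
    refine ⟨insert v N, Finset.card_insert_of_notMem hvN, ?_, ?_⟩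
    · intro c hc
      rcases Finset.mem_insert.1 hc with rfl | hc
      exacts [hv, h1 c hc]
    · intro c hc d hd hcd
      rcases Finset.mem_insert.1 hc with hcv | hcN <;>
        rcases Finset.mem_insert.1 hd with hdv | hdN
      · exact absurd (hcv.trans hdv.symm) hcd
      · exact hcv ▸ hfar d hdN
      · rw [norm_sub_rev, hdv]; exact hfar c hcN
      · exact h2 c hcN d hdN hcd
  have := le_csSup hbdd hmem
  omega

end Net

/-! ### Dual vectors and the least singular value -/

section DualFamily
variable {E J : Type*} [NormedAddCommGroup E] [InnerProductSpace ℝ E] [Fintype J] [DecidableEq J]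

/-- For linearly independent `w`, the dual basis of the span of the vectors `w j`; it is zero if
the Gram matrix of `w` is singular. -/
noncomputable def dualFamily (w : J → E) (j : J) : E :=
  ∑ i, (Matrix.gram ℝ w)⁻¹ j i • w i

theorem inner_dualFamily_of_isUnit {w : J → E} (hw : IsUnit (Matrix.gram ℝ w).det) (i j : J) :
    inner ℝ (dualFamily w i) (w j) = (1 : Matrix J J ℝ) i j := by
  rw [← Matrix.nonsing_inv_mul _ hw, Matrix.mul_apply, dualFamily, sum_inner]
  refine Finset.sum_congr rfl fun l _ => ?_
  rw [real_inner_smul_left, Matrix.gram_apply]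

theorem inner_dualFamily {w : J → E} (hw : LinearIndependent ℝ w) (i j : J) :
    inner ℝ (dualFamily w i) (w j) = (1 : Matrix J J ℝ) i j :=
  inner_dualFamily_of_isUnit
    (isUnit_iff_ne_zero.2 (Matrix.det_gram_ne_zero_iff_linearIndependent.2 hw)) i j

theorem measurable_dualFamily [MeasurableSpace E] [BorelSpace E] [SecondCountableTopology E]
    (j : J) : Measurable fun w : J → E => dualFamily w j := by
  have hg : Continuous fun w : J → E => Matrix.gram ℝ w := by
    refine continuous_matrix fun i l => ?_
    simp only [Matrix.gram_apply]
    fun_prop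
  have hi (i : J) : Measurable fun w : J → E => (Matrix.gram ℝ w)⁻¹ j i := by
    simp only [Matrix.inv_def, Ring.inverse_eq_inv', Matrix.smul_apply, smul_eq_mul]
    have h1 : Measurable fun w : J → E => (Matrix.gram ℝ w).det := hg.matrix_det.measurable
    have h2 : Measurable fun w : J → E => (Matrix.gram ℝ w).adjugate j i :=
      ((hg.matrix_adjugate).matrix_elem j i).measurable
    exact h1.inv.mul h2
  exact Finset.measurable_sum _ fun i _ => (hi i).smul (measurable_pi_apply i)

end DualFamily

section LowerBound
variable {E σ τ : Type*} [NormedAddCommGroup E] [InnerProductSpace ℝ E] [Fintype σ] [Fintype τ]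

/-- The squared least singular value, along the first block, of the residuals of the vectors
`w (inl s)` modulo the span of the vectors `w (inr t)`: the infimum of `‖∑ ζ j • w j‖²` over
all `ζ` whose first block has Euclidean norm one. -/
noncomputable def blockGap (w : σ ⊕ τ → E) : ℝ :=
  sInf ((fun ζ : σ ⊕ τ → ℝ => ‖∑ j, ζ j • w j‖ ^ 2) '' {ζ | ∑ s, ζ (Sum.inl s) ^ 2 = 1})

theorem bddBelow_blockGap (w : σ ⊕ τ → E) : BddBelow
    ((fun ζ : σ ⊕ τ → ℝ => ‖∑ j, ζ j • w j‖ ^ 2) '' {ζ | ∑ s, ζ (Sum.inl s) ^ 2 = 1}) :=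
  ⟨0, by rintro _ ⟨ζ, _, rfl⟩; positivity⟩

theorem blockGap_nonneg (w : σ ⊕ τ → E) : 0 ≤ blockGap w :=
  Real.sInf_nonneg (by rintro _ ⟨ζ, _, rfl⟩; positivity)

theorem blockGap_mul_le (w : σ ⊕ τ → E) (ζ : σ ⊕ τ → ℝ) :
    blockGap w * ∑ s, ζ (Sum.inl s) ^ 2 ≤ ‖∑ j, ζ j • w j‖ ^ 2 := by
  set Q := ∑ s, ζ (Sum.inl s) ^ 2
  have hQ0 : 0 ≤ Q := Finset.sum_nonneg fun _ _ => sq_nonneg _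
  rcases hQ0.eq_or_lt with hQ | hQ
  · rw [← hQ, mul_zero]; positivity
  have h : blockGap w ≤ ‖∑ j, ((√Q)⁻¹ * ζ j) • w j‖ ^ 2 := by
    refine csInf_le (bddBelow_blockGap w) ⟨fun j => (√Q)⁻¹ * ζ j, ?_, rfl⟩
    simp only [Set.mem_ofPred_eq, mul_pow]
    rw [← Finset.mul_sum, inv_pow, Real.sq_sqrt hQ0]
    exact inv_mul_cancel₀ hQ.ne'
  simp_rw [mul_smul] at h
  rw [← Finset.smul_sum, norm_smul, mul_pow, Real.norm_eq_abs, sq_abs, inv_pow, Real.sq_sqrt hQ0,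
    ← div_eq_inv_mul, le_div_iff₀ hQ] at h
  exact h

/-- The map whose rows are the dual vectors of the first block has squared norm at most
`1 / blockGap w`. If the Gram matrix is singular, the left-hand side is zero. -/
theorem blockGap_mul_norm_sum_dualFamily_sq_le [DecidableEq σ] [DecidableEq τ] (w : σ ⊕ τ → E)
    (c : σ → ℝ) :
    blockGap w * ‖∑ s, c s • dualFamily w (Sum.inl s)‖ ^ 2 ≤ ∑ s, c s ^ 2 := by
  have hC : 0 ≤ ∑ s, c s ^ 2 := Finset.sum_nonneg fun _ _ => sq_nonneg _
  by_cases hw : IsUnit (Matrix.gram ℝ w).det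
  · set v := ∑ s, c s • dualFamily w (Sum.inl s) with hv
    set ζ : σ ⊕ τ → ℝ := fun j => ∑ s, c s * (Matrix.gram ℝ w)⁻¹ (Sum.inl s) j
    have hvζ : v = ∑ j, ζ j • w j := by
      simp only [hv, dualFamily, Finset.smul_sum, smul_smul, ζ, Finset.sum_smul]
      rw [Finset.sum_comm]
    have hin (j : σ ⊕ τ) : inner ℝ v (w j) = Sum.elim c 0 j := by
      simp only [hv, sum_inner, real_inner_smul_left, inner_dualFamily_of_isUnit hw]
      rcases j with s | t <;> simp [Matrix.one_apply]
    have hnorm : ‖v‖ ^ 2 = ∑ s, ζ (Sum.inl s) * c s := by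
      rw [← real_inner_self_eq_norm_sq]
      conv_lhs => rw [hvζ, inner_sum, ← hvζ]
      simp [real_inner_smul_right, hin]
    have h1 := blockGap_mul_le w ζ
    rw [← hvζ] at h1
    have h2 := Finset.sum_mul_sq_le_sq_mul_sq Finset.univ (fun s => ζ (Sum.inl s)) c
    rw [← hnorm] at h2
    rcases (sq_nonneg ‖v‖).eq_or_lt with h0 | h0
    · rw [← h0, mul_zero]; exact hC
    · refine le_of_mul_le_mul_right ?_ h0
      have h3 := mul_le_mul_of_nonneg_left h2 (blockGap_nonneg w)
      have h4 := mul_le_mul_of_nonneg_right h1 hC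
      nlinarith
  · have : ∀ j, dualFamily w j = 0 := fun j => by
      simp [dualFamily, Matrix.nonsing_inv_apply_not_isUnit _ hw]
    simp [this, hC]

/-- Only the first block of coefficients is discretized; the coefficients of the second block are
absorbed in the distance to its span. The exponent `0.42` on the left is larger than the `2/5` in
`expNegSqDist` in order to pay for the discretization; `0.00336 = (2/5) * 21 / 2500`. -/
theorem ofReal_exp_neg_blockGap_le [Nonempty σ] (N : Finset (EuclideanSpace ℝ σ))
    (hN : ∀ v : EuclideanSpace ℝ σ, ‖v‖ = 1 → ∃ c ∈ N, ‖v - c‖ < 1 / 50) (w : σ ⊕ τ → E) {M : ℝ}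
    (hM : ∀ ζ : σ → ℝ, ‖∑ s, ζ s • w (Sum.inl s)‖ ^ 2 ≤ M * ∑ s, ζ s ^ 2) :
    ENNReal.ofReal (Real.exp (-(0.42 * blockGap w))) ≤
      ENNReal.ofReal (Real.exp (0.00336 * M)) *
        ∑ c ∈ N, expNegSqDist (∑ s, c s • w (Sum.inl s)) (fun t => w (Sum.inr t)) := by
  classical
  set B := ENNReal.ofReal (Real.exp (0.00336 * M)) *
        ∑ c ∈ N, expNegSqDist (∑ s, c s • w (Sum.inl s)) (fun t => w (Sum.inr t))
  have hne : ((fun ζ : σ ⊕ τ → ℝ => ‖∑ j, ζ j • w j‖ ^ 2) ''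
      {ζ | ∑ s, ζ (Sum.inl s) ^ 2 = 1}).Nonempty := by
    refine Set.Nonempty.image _ ⟨Sum.elim (Pi.single (Classical.arbitrary σ) 1) 0, ?_⟩
    simp [Pi.single_apply]
  have main : ∀ y, blockGap w < y → ENNReal.ofReal (Real.exp (-(0.42 * y))) ≤ B := by
    intro y hy
    obtain ⟨_, ⟨ζ, hζ, rfl⟩, hlt⟩ := exists_lt_of_csInf_lt hne hy
    simp only [Set.mem_ofPred_eq] at hζ hlt
    set v : EuclideanSpace ℝ σ := WithLp.toLp 2 fun s => ζ (Sum.inl s)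
    have hv : ‖v‖ = 1 := by
      rw [← sq_eq_sq₀ (norm_nonneg _) zero_le_one, EuclideanSpace.real_norm_sq_eq, one_pow, ← hζ]
    obtain ⟨c, hc, hvc⟩ := hN v hv
    have h1 : (∑ j, ζ j • w j) = (∑ s, c s • w (Sum.inl s) + ∑ t, ζ (Sum.inr t) • w (Sum.inr t))
        + ∑ s, (v - c) s • w (Sum.inl s) := by
      rw [Fintype.sum_sum_type]
      simp only [PiLp.sub_apply, sub_smul, Finset.sum_sub_distrib, v]
      abel
    have h2 := hM fun s => (v - c) s
    rw [← EuclideanSpace.real_norm_sq_eq] at h2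
    set p := ∑ s, c s • w (Sum.inl s) + ∑ t, ζ (Sum.inr t) • w (Sum.inr t)
    set d := ∑ s, (v - c) s • w (Sum.inl s)
    have hM0 : 0 ≤ M := by
      have := hM fun s => ζ (Sum.inl s)
      rw [hζ, mul_one] at this
      exact (sq_nonneg _).trans this
    have h3 : ‖v - c‖ ^ 2 ≤ 1 / 2500 := by
      have := norm_nonneg (v - c)
      nlinarith
    have h4 : ‖d‖ ^ 2 ≤ M / 2500 := h2.trans (by nlinarith)
    -- `‖p‖² ≤ (1 + 1/20) ‖p + d‖² + (1 + 20) ‖d‖²`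
    have h5 : ‖p‖ ^ 2 ≤ 1.05 * ‖p + d‖ ^ 2 + 21 * ‖d‖ ^ 2 := by
      have : ‖p‖ ≤ ‖p + d‖ + ‖d‖ := by simpa using norm_sub_le (p + d) d
      have h0 := norm_nonneg p
      nlinarith [sq_nonneg (‖p + d‖ - 20 * ‖d‖), norm_nonneg d, norm_nonneg (p + d)]
    rw [h1] at hlt
    calc ENNReal.ofReal (Real.exp (-(0.42 * y)))
        ≤ ENNReal.ofReal (Real.exp (0.00336 * M) * Real.exp (-(2 / 5 * ‖p‖ ^ 2))) := by
          rw [← Real.exp_add]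
          refine ENNReal.ofReal_le_ofReal (Real.exp_le_exp.2 ?_)
          linarith
      _ = ENNReal.ofReal (Real.exp (0.00336 * M)) *
            ENNReal.ofReal (Real.exp (-(2 / 5 * ‖p‖ ^ 2))) :=
          ENNReal.ofReal_mul (Real.exp_pos _).le
      _ ≤ B := by
          refine mul_le_mul_right ?_ _
          refine le_trans ?_ (Finset.single_le_sum
            (f := fun c : EuclideanSpace ℝ σ =>
              expNegSqDist (∑ s, c s • w (Sum.inl s)) (fun t => w (Sum.inr t)))
            (fun _ _ => zero_le) hc)
          exact le_iSup_of_le (fun t => ζ (Sum.inr t)) le_rfl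
  have hcont : Continuous fun y : ℝ => ENNReal.ofReal (Real.exp (-(0.42 * y))) :=
    ENNReal.continuous_ofReal.comp (by fun_prop)
  exact le_of_tendsto (hcont.continuousWithinAt (s := Set.Ioi (blockGap w)))
    (Filter.eventually_of_mem self_mem_nhdsWithin main)

end LowerBound

/-! ### Tail bounds for a fixed family of dual vectors -/

theorem MeasureTheory.measure_le_lintegral_of_forall_one_le {Ω : Type*} [MeasurableSpace Ω]
    {μ : Measure Ω} {s : Set Ω} {f : Ω → ℝ≥0∞} (hf : Measurable f) (h : ∀ ω ∈ s, 1 ≤ f ω) :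
    μ s ≤ ∫⁻ ω, f ω ∂μ := by
  have := mul_meas_ge_le_lintegral₀ (μ := μ) hf.aemeasurable 1
  rw [one_mul] at this
  exact (measure_mono h).trans this

/-- The event version of `ProbabilityTheory.IndepFun.lintegral_le`, restricted to values of `X` in
`K`. -/
theorem ProbabilityTheory.IndepFun.measure_le {Ω α β : Type*} [MeasurableSpace Ω]
    [MeasurableSpace α] [MeasurableSpace β] {μ : Measure Ω} [IsProbabilityMeasure μ]
    {X : Ω → α} {Y : Ω → β} (hX : Measurable X) (hY : Measurable Y) (h : IndepFun X Y μ)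
    {K : Set α} (hK : MeasurableSet K) {G : Set (α × β)} (hG : MeasurableSet G) {g : α → ℝ≥0∞}
    (hg : ∀ x ∈ K, μ {ω | (x, Y ω) ∈ G} ≤ g x) :
    μ {ω | X ω ∈ K ∧ (X ω, Y ω) ∈ G} ≤ ∫⁻ ω, K.indicator g (X ω) ∂μ := by
  set H : Set (α × β) := {p | p.1 ∈ K ∧ p ∈ G}
  have hH : MeasurableSet H := (measurable_fst hK).inter hG
  have h1 : μ {ω | X ω ∈ K ∧ (X ω, Y ω) ∈ G} = ∫⁻ ω, H.indicator 1 (X ω, Y ω) ∂μ := by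
    exact (lintegral_indicator_one ((hX.prodMk hY) hH)).symm
  rw [h1]
  refine h.lintegral_le hX hY (f := fun x y => H.indicator 1 (x, y))
    ((measurable_one.indicator hH)) fun x => ?_
  have h2 : ∫⁻ ω, H.indicator (1 : α × β → ℝ≥0∞) (x, Y ω) ∂μ = μ {ω | (x, Y ω) ∈ H} := by
    exact lintegral_indicator_one ((measurable_const.prodMk hY) hH)
  rw [h2]
  by_cases hx : x ∈ K
  · rw [Set.indicator_of_mem hx]
    exact (measure_mono fun ω hω => hω.2).trans (hg x hx)
  · have : {ω | (x, Y ω) ∈ H} = ∅ := Set.eq_empty_of_forall_notMem fun ω hω => hx hω.1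
    rw [this, measure_empty]
    exact zero_le

namespace IsStdVector
variable {Ω ι σ τ ρ : Type*} [MeasurableSpace Ω] {μ : Measure Ω} [IsProbabilityMeasure μ]
  [Fintype ι] [Fintype σ] [Fintype τ] [Fintype ρ] [DecidableEq σ] [DecidableEq τ]
  {z : Ω → EuclideanSpace ℝ ι}

/-- Gaussian linearization for the rescaled dual vectors, with `q = 0.42`, followed by Markov's
inequality; `2.5 = (1 - 2 * 0.42) ^ (-1/2)`. -/
theorem measure_one_lt_sum_inner_dualFamily_sq_le (h : IsStdVector z μ)
    (w : σ ⊕ τ → EuclideanSpace ℝ ι) :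
    μ {ω | 1 < ∑ s : σ, inner ℝ (dualFamily w (Sum.inl s)) (z ω) ^ 2} ≤
      ENNReal.ofReal (2.5 ^ Fintype.card σ) * ENNReal.ofReal (Real.exp (-(0.42 * blockGap w))) := by
  have hz := h.measurable
  set l := blockGap w
  have hl : 0 ≤ l := blockGap_nonneg w
  have key := h.lintegral_exp_mul_sum_inner_sq_le
    (r := fun s : σ => √l • dualFamily w (Sum.inl s)) (q := 0.42) (fun g => by
      have := blockGap_mul_norm_sum_dualFamily_sq_le w g
      simp_rw [smul_comm _ (√l)]
      rw [← Finset.smul_sum, norm_smul, mul_pow, Real.norm_eq_abs, sq_abs, Real.sq_sqrt hl]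
      exact this) (by norm_num) (by norm_num)
  have h25 : (√(1 - 2 * 0.42))⁻¹ = (2.5 : ℝ) := by
    rw [show (1 - 2 * 0.42 : ℝ) = 0.4 ^ 2 by norm_num, Real.sqrt_sq (by norm_num)]; norm_num
  rw [h25] at key
  refine (measure_le_lintegral_of_forall_one_le (f := fun ω =>
    ENNReal.ofReal (Real.exp (0.42 * ∑ s, inner ℝ (√l • dualFamily w (Sum.inl s)) (z ω) ^ 2)) *
      ENNReal.ofReal (Real.exp (-(0.42 * l)))) (by fun_prop) fun ω hω => ?_).trans ?_
  · rw [← ENNReal.ofReal_mul (Real.exp_pos _).le, ← Real.exp_add, ← ENNReal.ofReal_one]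
    refine ENNReal.ofReal_le_ofReal (Real.one_le_exp ?_)
    simp_rw [real_inner_smul_left, mul_pow, Real.sq_sqrt hl]
    rw [← Finset.mul_sum]
    have := mul_le_mul_of_nonneg_left (le_of_lt hω) hl
    linarith
  · rw [lintegral_mul_const _ (by fun_prop)]
    exact mul_le_mul_left key _

/-- By convexity of the exponential, a quadratic form of trace at most `V` is no worse than a single
square `V ⟨u, z⟩²` with `‖u‖ = 1`; `√10 = (1 - 2 * 0.45) ^ (-1/2)`. -/
theorem lintegral_exp_sum_inner_sq_le_sqrt_ten (h : IsStdVector z μ) {V : ℝ} (hV : 0 < V)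
    (v : ρ → EuclideanSpace ℝ ι) (hv : ∑ q, ‖v q‖ ^ 2 ≤ V) :
    ∫⁻ ω, ENNReal.ofReal (Real.exp (0.45 / V * ∑ q, inner ℝ (v q) (z ω) ^ 2)) ∂μ ≤
      ENNReal.ofReal √10 := by
  have hz := h.measurable
  set p : ρ → ℝ := fun q => ‖v q‖ ^ 2 / V
  have hp (q : ρ) : 0 ≤ p q := by positivity
  have hp1 : ∑ q, p q ≤ 1 := by
    rw [← Finset.sum_div]
    exact (div_le_one hV).2 hv
  set u : ρ → EuclideanSpace ℝ ι := fun q => ‖v q‖⁻¹ • v q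
  have h10 : (√(1 - 2 * 0.45))⁻¹ = √10 := by
    rw [← Real.sqrt_inv]; norm_num
  have key (q : ρ) : ∫⁻ ω, ENNReal.ofReal (Real.exp (0.45 * inner ℝ (u q) (z ω) ^ 2)) ∂μ ≤
      ENNReal.ofReal √10 := by
    have := h.lintegral_exp_mul_sum_inner_sq_le (r := fun _ : Unit => u q) (q := 0.45) (fun g => by
      simp only [Finset.univ_unique, Finset.sum_singleton, norm_smul, mul_pow, u, norm_inv,
        Real.norm_eq_abs, sq_abs, abs_norm]
      have : (‖v q‖⁻¹ * ‖v q‖) ^ 2 ≤ 1 := by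
        rcases eq_or_ne ‖v q‖ 0 with h0 | h0
        · simp [h0]
        · rw [inv_mul_cancel₀ h0]; norm_num
      rw [← mul_pow ‖v q‖⁻¹]
      nlinarith [sq_nonneg (g default)]) (by norm_num) (by norm_num)
    simpa [h10] using this
  have hconv (ω : Ω) : Real.exp (0.45 / V * ∑ q, inner ℝ (v q) (z ω) ^ 2) ≤
      (1 - ∑ q, p q) + ∑ q, p q * Real.exp (0.45 * inner ℝ (u q) (z ω) ^ 2) := by
    -- the index `none` carries the missing weight
    have := convexOn_exp.map_sum_le (t := (Finset.univ : Finset (Option ρ)))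
      (w := fun o => o.elim (1 - ∑ q, p q) p)
      (p := fun o => o.elim 0 fun q => 0.45 * inner ℝ (u q) (z ω) ^ 2)
      (by rintro (_ | q) _; exacts [by simpa using hp1, hp q])
      (by simp [Fintype.sum_option]) (by simp)
    simp only [Fintype.sum_option, Option.elim, smul_eq_mul, mul_zero, zero_add, Real.exp_zero,
      mul_one] at this
    refine le_trans (le_of_eq ?_) this
    rw [Finset.mul_sum]
    congr 1
    refine Finset.sum_congr rfl fun q _ => ?_
    simp only [p, u, real_inner_smul_left, mul_pow]
    rcases eq_or_ne ‖v q‖ 0 with h0 | h0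
    · simp [norm_eq_zero.1 h0]
    · field_simp
  calc _ ≤ ∫⁻ ω, (ENNReal.ofReal (1 - ∑ q, p q) + ∑ q, ENNReal.ofReal (p q) *
        ENNReal.ofReal (Real.exp (0.45 * inner ℝ (u q) (z ω) ^ 2))) ∂μ := by
        refine lintegral_mono fun ω => (ENNReal.ofReal_le_ofReal (hconv ω)).trans (le_of_eq ?_)
        rw [ENNReal.ofReal_add (by linarith) (Finset.sum_nonneg fun q _ => mul_nonneg (hp q)
          (Real.exp_pos _).le), ENNReal.ofReal_sum_of_nonneg fun q _ => mul_nonneg (hp q)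
          (Real.exp_pos _).le]
        simp_rw [ENNReal.ofReal_mul (hp _)]
    _ = ENNReal.ofReal (1 - ∑ q, p q) + ∑ q, ENNReal.ofReal (p q) *
        ∫⁻ ω, ENNReal.ofReal (Real.exp (0.45 * inner ℝ (u q) (z ω) ^ 2)) ∂μ := by
        rw [lintegral_add_left measurable_const, lintegral_const, measure_univ, mul_one,
          lintegral_finsetSum _ fun q _ => by fun_prop]
        congr 1
        exact Finset.sum_congr rfl fun q _ => lintegral_const_mul _ (by fun_prop)
    _ ≤ ENNReal.ofReal (1 - ∑ q, p q) + ∑ q, ENNReal.ofReal (p q) * ENNReal.ofReal √10 := by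
        gcongr with q
        exact key q
    _ = ENNReal.ofReal ((1 - ∑ q, p q) + (∑ q, p q) * √10) := by
        rw [ENNReal.ofReal_add (by linarith) (mul_nonneg (Finset.sum_nonneg fun q _ => hp q)
          (Real.sqrt_nonneg _)), ENNReal.ofReal_mul (Finset.sum_nonneg fun q _ => hp q),
          ENNReal.ofReal_sum_of_nonneg fun q _ => hp q, Finset.sum_mul]
    _ ≤ ENNReal.ofReal √10 := by
        refine ENNReal.ofReal_le_ofReal ?_
        have : 1 ≤ √10 := by rw [Real.one_le_sqrt]; norm_num
        nlinarith

/-- The excess over the level `0.97` is linearized by a quadratic: `0.8 (y - 0.97)` is at most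
`0.45 y² - 0.42` for all `y`. -/
theorem lintegral_exp_excess_le (h : IsStdVector z μ) {V : ℝ} (hV : 0 < V)
    (v : ρ → EuclideanSpace ℝ ι) (hv : ∑ q, ‖v q‖ ^ 2 ≤ V) :
    ∫⁻ ω, ENNReal.ofReal (Real.exp (0.8 / V *
      max 0 (√(∑ q, inner ℝ (v q) (z ω) ^ 2) - 0.97))) ∂μ ≤
      ENNReal.ofReal (Real.exp (√10 * Real.exp (-(0.42 / V)))) := by
  have hz := h.measurable
  have hb (ω : Ω) : Real.exp (0.8 / V * max 0 (√(∑ q, inner ℝ (v q) (z ω) ^ 2) - 0.97)) ≤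
      1 + Real.exp (-(0.42 / V)) * Real.exp (0.45 / V * ∑ q, inner ℝ (v q) (z ω) ^ 2) := by
    set y := √(∑ q, inner ℝ (v q) (z ω) ^ 2)
    have hy : ∑ q, inner ℝ (v q) (z ω) ^ 2 = y ^ 2 :=
      (Real.sq_sqrt (Finset.sum_nonneg fun _ _ => sq_nonneg _)).symm
    rw [hy, ← Real.exp_add]
    have h1 : 0.8 / V * (y - 0.97) ≤ -(0.42 / V) + 0.45 / V * y ^ 2 := by
      rw [← sub_nonneg]
      have : -(0.42 / V) + 0.45 / V * y ^ 2 - 0.8 / V * (y - 0.97) =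
        (0.45 * y ^ 2 - 0.8 * y + 0.356) / V := by ring
      rw [this]
      refine div_nonneg ?_ hV.le
      nlinarith [sq_nonneg (y - 8 / 9)]
    rcases le_total (y - 0.97) 0 with h0 | h0
    · rw [max_eq_left h0, mul_zero, Real.exp_zero]
      linarith [Real.exp_pos (-(0.42 / V) + 0.45 / V * y ^ 2)]
    · rw [max_eq_right h0]
      linarith [Real.exp_le_exp.2 h1]
  calc _ ≤ ∫⁻ ω, (1 + ENNReal.ofReal (Real.exp (-(0.42 / V))) *
        ENNReal.ofReal (Real.exp (0.45 / V * ∑ q, inner ℝ (v q) (z ω) ^ 2))) ∂μ := by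
        refine lintegral_mono fun ω => (ENNReal.ofReal_le_ofReal (hb ω)).trans (le_of_eq ?_)
        rw [ENNReal.ofReal_add zero_le_one (by positivity), ENNReal.ofReal_one,
          ENNReal.ofReal_mul (Real.exp_pos _).le]
    _ ≤ 1 + ENNReal.ofReal (Real.exp (-(0.42 / V))) * ENNReal.ofReal √10 := by
        rw [lintegral_add_left measurable_const, lintegral_const, measure_univ, mul_one,
          lintegral_const_mul _ (by fun_prop)]
        gcongr
        exact h.lintegral_exp_sum_inner_sq_le_sqrt_ten hV v hv
    _ ≤ _ := by
        rw [← ENNReal.ofReal_one, ← ENNReal.ofReal_mul (Real.exp_pos _).le,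
          ← ENNReal.ofReal_add zero_le_one (by positivity)]
        refine ENNReal.ofReal_le_ofReal ?_
        have := Real.add_one_le_exp (√10 * Real.exp (-(0.42 / V)))
        linarith

end IsStdVector

/-! ### Linear independence and norms of random submatrices -/

namespace IsStdFamily
variable {Ω ι κ σ τ θ : Type*} [MeasurableSpace Ω] {μ : Measure Ω}
  {a : κ → Ω → EuclideanSpace ℝ ι}

theorem precomp (h : IsStdFamily a μ) {e : θ → κ} (he : Function.Injective e) :
    IsStdFamily (fun i => a (e i)) μ where
  measurable i := h.measurable _
  indep := h.indep.precomp (g := fun p : θ × ι => (e p.1, p.2)) fun p q hpq => by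
    obtain ⟨h1, h2⟩ := Prod.mk.inj hpq
    exact Prod.ext (he h1) h2
  subGaussian i := h.subGaussian _

theorem indepFun_of_forall_ne [Fintype σ] [Fintype τ] (h : IsStdFamily a μ) (e : σ → κ) (f : τ → κ)
    (hef : ∀ i j, e i ≠ f j) :
    IndepFun (fun ω i => a (e i) ω) (fun ω j => a (f j) ω) μ := by
  classical
  have hd : Disjoint (Finset.univ.image e) (Finset.univ.image f) := by
    rw [Finset.disjoint_left]
    intro x hx hx'
    obtain ⟨i, _, rfl⟩ := Finset.mem_image.1 hx
    obtain ⟨j, _, hj⟩ := Finset.mem_image.1 hx'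
    exact hef i j hj.symm
  have h1 := h.iIndepFun_columns.indepFun_finset _ _ hd h.measurable
  exact h1.comp
    (φ := fun x i => x ⟨e i, Finset.mem_image_of_mem _ (Finset.mem_univ i)⟩)
    (ψ := fun x i => x ⟨f i, Finset.mem_image_of_mem _ (Finset.mem_univ i)⟩)
    (by fun_prop) (by fun_prop)

variable [Fintype ι] [Fintype σ] [Fintype τ]

theorem lintegral_expNegSqDist_le [IsProbabilityMeasure μ] (h : IsStdFamily a μ) {e : σ ⊕ τ → κ}
    (he : Function.Injective e) {c : EuclideanSpace ℝ σ} (hc : ‖c‖ = 1) :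
    ∫⁻ ω, expNegSqDist (∑ s, c s • a (e (Sum.inl s)) ω) (fun t => a (e (Sum.inr t)) ω) ∂μ ≤
      ENNReal.ofReal (Real.exp (-0.263 * Fintype.card ι) * √5 ^ Fintype.card τ) := by
  have hm := h.measurable
  have hz : IsStdVector (fun ω => ∑ s, c s • a (e (Sum.inl s)) ω) μ := by
    refine (h.precomp (he.comp Sum.inl_injective)).isStdVector_sum Finset.univ (fun s => c s) ?_
    rw [← EuclideanSpace.real_norm_sq_eq, hc, one_pow]
  have hind := h.indepFun_of_forall_ne (fun t => e (Sum.inr t)) (fun s => e (Sum.inl s))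
    fun t s hts => Sum.inr_ne_inl (he hts)
  have hind' := hind.comp (φ := id) (ψ := fun x : σ → EuclideanSpace ℝ ι => ∑ s, c s • x s)
    measurable_id (by fun_prop)
  have := hind'.lintegral_le (μ := μ) (f := fun x y => expNegSqDist y x)
    (g := fun _ => ENNReal.ofReal (Real.exp (-0.263 * Fintype.card ι) * √5 ^ Fintype.card τ))
    (by fun_prop) (by fun_prop)
    (measurable_snd.expNegSqDist measurable_fst) fun x => hz.lintegral_expNegSqDist_le x
  simpa using this

/-- The columns are added one at a time. The new column lies in the span of the previous ones only
if `expNegSqDist` is `1`, so the failure probabilities form a geometric series of ratio `√5 ≥ 2`,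
which is bounded by its next term. -/
theorem measure_not_linearIndepOn_le [IsProbabilityMeasure μ] (h : IsStdFamily a μ) (J : Finset κ) :
    μ {ω | ¬ LinearIndepOn ℝ (fun j => a j ω) (J : Set κ)} ≤
      ENNReal.ofReal (Real.exp (-0.263 * Fintype.card ι) * √5 ^ J.card) := by
  classical
  have h5 : 2 ≤ √5 := by
    rw [Real.le_sqrt (by norm_num) (by norm_num)]; norm_num
  have hm := h.measurable
  induction J using Finset.induction with
  | empty => simp
  | insert j J hj ih =>
    have hsub : {ω | ¬ LinearIndepOn ℝ (fun j => a j ω) ((insert j J : Finset κ) : Set κ)} ⊆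
        {ω | ¬ LinearIndepOn ℝ (fun j => a j ω) (J : Set κ)} ∪
          {ω | a j ω ∈ Submodule.span ℝ (Set.range fun t : J => a t ω)} := by
      intro ω hω
      by_contra hcon
      simp only [Set.mem_union, Set.mem_ofPred_eq, not_or, not_not] at hcon
      refine hω ?_
      rw [Finset.coe_insert, linearIndepOn_insert (by simpa using hj)]
      refine ⟨hcon.1, ?_⟩
      rw [Set.image_eq_range]
      exact hcon.2
    have hspan : μ {ω | a j ω ∈ Submodule.span ℝ (Set.range fun t : J => a t ω)} ≤
        ENNReal.ofReal (Real.exp (-0.263 * Fintype.card ι) * √5 ^ J.card) := by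
      refine (measure_le_lintegral_of_forall_one_le
        (f := fun ω => expNegSqDist (a j ω) fun t : J => a t ω)
        ((hm j).expNegSqDist (by fun_prop))
        fun ω hω => (expNegSqDist_eq_one_of_mem_span hω).ge).trans ?_
      have := h.lintegral_expNegSqDist_le (σ := Unit) (τ := J) (e := Sum.elim (fun _ => j) (↑))
        (Function.Injective.sumElim (Function.injective_of_subsingleton _) Subtype.val_injective
          fun _ t hjt => hj (hjt ▸ t.2)) (c := WithLp.toLp 2 fun _ => 1) (by
            rw [← sq_eq_sq₀ (norm_nonneg _) zero_le_one, EuclideanSpace.real_norm_sq_eq]; simp)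
      simpa using this
    calc _ ≤ _ := measure_mono hsub
      _ ≤ _ := measure_union_le _ _
      _ ≤ _ := add_le_add ih hspan
      _ ≤ _ := by
        rw [← ENNReal.ofReal_add (by positivity) (by positivity), Finset.card_insert_of_notMem hj]
        refine ENNReal.ofReal_le_ofReal ?_
        have : 0 < Real.exp (-0.263 * Fintype.card ι) * √5 ^ J.card := by positivity
        rw [pow_succ]
        nlinarith

/-- With probability exponentially close to one, the matrix with columns `a (e s)` has squared
operator norm at most `2.3` times the dimension. On the net the bound `2.2` is enough, as
`2.2 * (50/49)² ≤ 2.3`. -/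
theorem measure_exists_norm_sq_gt_le [IsProbabilityMeasure μ] (h : IsStdFamily a μ) {e : σ → κ}
    (he : Function.Injective e) :
    μ {ω | ∃ ζ : σ → ℝ, 2.3 * Fintype.card ι * ∑ s, ζ s ^ 2 < ‖∑ s, ζ s • a (e s) ω‖ ^ 2} ≤
      ENNReal.ofReal (101 ^ Fintype.card σ * Real.exp (-0.2 * Fintype.card ι)) := by
  have hm := h.measurable
  set m : ℝ := (Fintype.card ι : ℝ) with hm_def
  have hm0 : 0 ≤ m := Nat.cast_nonneg _
  obtain ⟨N, hN1, hNcard, hN⟩ := exists_finset_sphere_net (E := EuclideanSpace ℝ σ)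
    (ε := 1 / 50) (by norm_num)
  have hsub : {ω | ∃ ζ : σ → ℝ, 2.3 * m * ∑ s, ζ s ^ 2 < ‖∑ s, ζ s • a (e s) ω‖ ^ 2} ⊆
      ⋃ c ∈ N, {ω | 2.2 * m < ‖∑ s, c s • a (e s) ω‖ ^ 2} := by
    rintro ω ⟨ζ, hζ⟩
    by_contra hcon
    simp only [Set.mem_iUnion, Set.mem_ofPred_eq, not_exists, not_lt] at hcon
    set L : EuclideanSpace ℝ σ →L[ℝ] EuclideanSpace ℝ ι :=
      ∑ s, (EuclideanSpace.proj s : EuclideanSpace ℝ σ →L[ℝ] ℝ).smulRight (a (e s) ω)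
    have hL (v : EuclideanSpace ℝ σ) : L v = ∑ s, v s • a (e s) ω := by
      simp [L]
    have hb : ‖L‖ ≤ √(2.2 * m) + ‖L‖ * (1 / 50) := by
      refine ContinuousLinearMap.opNorm_le_of_unit_norm (by positivity) fun v hv => ?_
      obtain ⟨c, hc, hvc⟩ := hN v hv
      have h1 : ‖L c‖ ≤ √(2.2 * m) := Real.le_sqrt_of_sq_le (by rw [hL]; exact hcon c hc)
      have h2 : L v = L c + L (v - c) := by rw [map_sub]; abel
      rw [h2]
      refine (norm_add_le _ _).trans (add_le_add h1 ((L.le_opNorm _).trans ?_))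
      exact mul_le_mul_of_nonneg_left hvc.le (norm_nonneg _)
    have h3 : ‖L‖ ^ 2 ≤ 2.3 * m := by
      have h4 : ‖L‖ ≤ 50 / 49 * √(2.2 * m) := by linarith
      have h5 : ‖L‖ ^ 2 ≤ (50 / 49 * √(2.2 * m)) ^ 2 := pow_le_pow_left₀ (norm_nonneg _) h4 2
      rw [mul_pow, Real.sq_sqrt (by positivity)] at h5
      nlinarith
    have h6 := L.le_opNorm (WithLp.toLp 2 ζ)
    have h7 := pow_le_pow_left₀ (norm_nonneg _) h6 2
    rw [mul_pow, EuclideanSpace.real_norm_sq_eq (WithLp.toLp 2 ζ), hL] at h7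
    have h8 : ‖L‖ ^ 2 * ∑ s, ζ s ^ 2 ≤ 2.3 * m * ∑ s, ζ s ^ 2 :=
      mul_le_mul_of_nonneg_right h3 (Finset.sum_nonneg fun _ _ => sq_nonneg _)
    exact absurd (h7.trans h8) (not_le.2 hζ)
  have hone (c : EuclideanSpace ℝ σ) (hc : c ∈ N) :
      μ {ω | 2.2 * m < ‖∑ s, c s • a (e s) ω‖ ^ 2} ≤ ENNReal.ofReal (Real.exp (-0.2 * m)) := by
    have hz : IsStdVector (fun ω => ∑ s, c s • a (e s) ω) μ := by
      refine (h.precomp he).isStdVector_sum Finset.univ (fun s => c s) ?_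
      rw [← EuclideanSpace.real_norm_sq_eq, hN1 c hc, one_pow]
    have hz' := hz.measurable
    refine (measure_le_lintegral_of_forall_one_le (f := fun ω =>
      ENNReal.ofReal (Real.exp (0.25 * ‖∑ s, c s • a (e s) ω‖ ^ 2)) *
        ENNReal.ofReal (Real.exp (-(0.55 * m)))) (by fun_prop) fun ω hω => ?_).trans ?_
    · rw [← ENNReal.ofReal_mul (Real.exp_pos _).le, ← Real.exp_add, ← ENNReal.ofReal_one]
      refine ENNReal.ofReal_le_ofReal (Real.one_le_exp ?_)
      have : 2.2 * m < ‖∑ s, c s • a (e s) ω‖ ^ 2 := hω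
      linarith
    · rw [lintegral_mul_const _ (by fun_prop)]
      refine (mul_le_mul_left (hz.lintegral_exp_mul_norm_sq_le (q := 0.25) (by norm_num)
        (by norm_num)) _).trans ?_
      rw [← ENNReal.ofReal_mul (by positivity)]
      refine ENNReal.ofReal_le_ofReal ?_
      have h1 : (√(1 - 2 * 0.25))⁻¹ ≤ Real.exp 0.35 := by
        rw [← Real.sqrt_inv, Real.sqrt_le_left (Real.exp_pos _).le, ← Real.exp_nat_mul]
        have : (1 - 2 * 0.25 : ℝ)⁻¹ = 2 := by norm_num
        rw [this, ← Real.log_le_iff_le_exp two_pos]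
        have := Real.log_two_lt_d9
        norm_num at *
        linarith
      have h2 : (√(1 - 2 * 0.25))⁻¹ ^ Fintype.card ι ≤ Real.exp (0.35 * m) := by
        refine (pow_le_pow_left₀ (by positivity) h1 _).trans (le_of_eq ?_)
        rw [← Real.exp_nat_mul, mul_comm]
      refine (mul_le_mul_of_nonneg_right h2 (Real.exp_pos _).le).trans (le_of_eq ?_)
      rw [← Real.exp_add]
      congr 1
      ring
  calc _ ≤ _ := measure_mono hsub
    _ ≤ ∑ c ∈ N, μ {ω | 2.2 * m < ‖∑ s, c s • a (e s) ω‖ ^ 2} := measure_biUnion_finset_le _ _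
    _ ≤ ∑ c ∈ N, ENNReal.ofReal (Real.exp (-0.2 * m)) := Finset.sum_le_sum hone
    _ = ENNReal.ofReal (N.card * Real.exp (-0.2 * m)) := by
      rw [Finset.sum_const, nsmul_eq_mul, ENNReal.ofReal_mul (Nat.cast_nonneg _),
        ENNReal.ofReal_natCast]
    _ ≤ _ := by
      refine ENNReal.ofReal_le_ofReal (mul_le_mul_of_nonneg_right ?_ (Real.exp_pos _).le)
      refine hNcard.trans (le_of_eq ?_)
      rw [finrank_euclideanSpace]
      norm_num

end IsStdFamily

/-! ### Integration over the conditioning columns -/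

section BlockNorm
variable {E σ τ : Type*} [NormedAddCommGroup E] [InnerProductSpace ℝ E] [Fintype σ]

/-- The families whose first block, as a matrix, has squared operator norm at most `M`. -/
def blockNormLE (σ τ : Type*) {E : Type*} [NormedAddCommGroup E] [InnerProductSpace ℝ E]
    [Fintype σ] (M : ℝ) : Set (σ ⊕ τ → E) :=
  {w | ∀ ζ : σ → ℝ, ‖∑ s, ζ s • w (Sum.inl s)‖ ^ 2 ≤ M * ∑ s, ζ s ^ 2}

theorem measurableSet_blockNormLE [Finite τ] [MeasurableSpace E] [BorelSpace E]
    [SecondCountableTopology E] (M : ℝ) :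
    MeasurableSet (blockNormLE σ τ M : Set (σ ⊕ τ → E)) := by
  refine IsClosed.measurableSet ?_
  rw [blockNormLE, Set.ofPred_forall]
  exact isClosed_iInter fun ζ => isClosed_le (by fun_prop) continuous_const

end BlockNorm

namespace IsStdFamily
variable {Ω ι κ σ τ ρ θ : Type*} [MeasurableSpace Ω] {μ : Measure Ω} [IsProbabilityMeasure μ]
  {a : κ → Ω → EuclideanSpace ℝ ι} [Fintype ι] [Fintype σ] [Fintype τ] [Fintype ρ] [Fintype θ]

/-- For a fixed family `w`, a large total excess over the level `0.97` is unlikely. If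
`l = blockGap w` is less than `0.08` times the dimension, the right-hand side is at least one.
Otherwise the exponential moment of the total excess, with parameter `0.8 l / k`, is bounded
column by column; by `hθ` its logarithm is at most `√10 k`. -/
theorem measure_lt_sum_excess_le [DecidableEq σ] [DecidableEq τ]
    {b : θ → Ω → EuclideanSpace ℝ ι} (h : IsStdFamily b μ)
    (w : σ ⊕ τ → EuclideanSpace ℝ ι) (C : ρ → σ → ℝ) {k : ℝ} (hk : 0 < k)
    (hC : ∑ q, ∑ s, C q s ^ 2 ≤ k) (hkm : 83 * k ≤ Fintype.card ι)
    (hθ : Fintype.card θ * Real.exp (-(0.0336 * Fintype.card ι / k)) ≤ k) :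
    μ {ω | 0.97 * k < ∑ i, max 0 (√(∑ q, (∑ s, C q s *
        inner ℝ (dualFamily w (Sum.inl s)) (b i ω)) ^ 2) - 0.97)} ≤
      ENNReal.ofReal (Real.exp (0.0336 * Fintype.card ι)) *
        ENNReal.ofReal (Real.exp (-(0.42 * blockGap w))) := by
  have hb := h.measurable
  set m : ℝ := (Fintype.card ι : ℝ) with hm_def
  set l := blockGap w with hl_def
  rcases le_total l (0.08 * m) with hl | hl
  · refine prob_le_one.trans ?_
    rw [← ENNReal.ofReal_mul (Real.exp_pos _).le, ← Real.exp_add, ← ENNReal.ofReal_one]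
    refine ENNReal.ofReal_le_ofReal (Real.one_le_exp ?_)
    linarith
  have hl0 : 0 < l := by linarith
  set v : ρ → EuclideanSpace ℝ ι := fun q => ∑ s, C q s • dualFamily w (Sum.inl s) with hv_def
  have hinner (q : ρ) (i : θ) (ω : Ω) :
      ∑ s, C q s * inner ℝ (dualFamily w (Sum.inl s)) (b i ω) = inner ℝ (v q) (b i ω) := by
    simp [hv_def, sum_inner, real_inner_smul_left]
  simp_rw [hinner]
  have hV : 0 < k / l := by positivity
  have hv : ∑ q, ‖v q‖ ^ 2 ≤ k / l := by
    rw [le_div_iff₀ hl0, Finset.sum_mul]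
    refine le_trans (Finset.sum_le_sum fun q _ => ?_) hC
    rw [mul_comm]
    exact blockGap_mul_norm_sum_dualFamily_sq_le w (C q)
  set y : EuclideanSpace ℝ ι → ℝ := fun x => max 0 (√(∑ q, inner ℝ (v q) x ^ 2) - 0.97)
  have hy : Measurable y := by fun_prop
  set f : EuclideanSpace ℝ ι → ℝ≥0∞ := fun x => ENNReal.ofReal (Real.exp (0.8 / (k / l) * y x))
  have hf : Measurable f := by fun_prop
  have hfi (i : θ) : ∫⁻ ω, f (b i ω) ∂μ ≤
      ENNReal.ofReal (Real.exp (√10 * Real.exp (-(0.42 / (k / l))))) :=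
    (h.isStdVector i).lintegral_exp_excess_le hV v hv
  have hprod := lintegral_prod_eq_prod_lintegral_of_indepFun Finset.univ (fun i ω => f (b i ω))
    (h.iIndepFun_columns.comp (fun _ => f) fun _ => hf) fun i => hf.comp (hb i)
  refine (measure_le_lintegral_of_forall_one_le (f := fun ω =>
    (∏ i, f (b i ω)) * ENNReal.ofReal (Real.exp (-(0.776 * l)))) (by fun_prop)
      fun ω hω => ?_).trans ?_
  · have hω' : 0.97 * k < ∑ i, y (b i ω) := hω
    simp only [f]
    rw [← ENNReal.ofReal_prod_of_nonneg fun _ _ => (Real.exp_pos _).le, ← Real.exp_sum,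
      ← ENNReal.ofReal_mul (Real.exp_pos _).le, ← Real.exp_add, ← ENNReal.ofReal_one]
    refine ENNReal.ofReal_le_ofReal (Real.one_le_exp ?_)
    rw [← Finset.mul_sum]
    have h1 := mul_le_mul_of_nonneg_left hω'.le (show 0 ≤ 0.8 / (k / l) by positivity)
    have h2 : 0.8 / (k / l) * (0.97 * k) = 0.776 * l := by field_simp; norm_num
    linarith
  · rw [lintegral_mul_const _ (by fun_prop), hprod, ← ENNReal.ofReal_mul (Real.exp_pos _).le,
      ← Real.exp_add]
    refine (mul_le_mul_left (Finset.prod_le_prod' fun i _ => hfi i) _).trans ?_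
    rw [Finset.prod_const, Finset.card_univ, ← ENNReal.ofReal_pow (Real.exp_pos _).le,
      ← Real.exp_nat_mul, ← ENNReal.ofReal_mul (Real.exp_pos _).le, ← Real.exp_add]
    refine ENNReal.ofReal_le_ofReal (Real.exp_le_exp.2 ?_)
    have h1 : Real.exp (-(0.42 / (k / l))) ≤ Real.exp (-(0.0336 * m / k)) := by
      refine Real.exp_le_exp.2 (neg_le_neg ?_)
      rw [div_div_eq_mul_div]
      exact div_le_div_of_nonneg_right (by linarith) hk.le
    have h2 : √10 ≤ 3.17 := by
      rw [Real.sqrt_le_left (by norm_num)]; norm_num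
    have h3 : Fintype.card θ * Real.exp (-(0.42 / (k / l))) ≤ k :=
      (mul_le_mul_of_nonneg_left h1 (Nat.cast_nonneg _)).trans hθ
    have h4 : Fintype.card θ * (√10 * Real.exp (-(0.42 / (k / l)))) ≤ 3.17 * k := by
      calc _ = √10 * (Fintype.card θ * Real.exp (-(0.42 / (k / l)))) := by ring
        _ ≤ 3.17 * k := mul_le_mul h2 h3 (by positivity) (by norm_num)
    linarith

/-- The expectation of `exp (-0.42 l)`, where `l` is the block gap of random columns, on the event
that the columns of the first block form a matrix of controlled norm: a sum over a net of
expectations of `expNegSqDist`. -/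
theorem lintegral_indicator_exp_neg_blockGap_le [Nonempty σ] (h : IsStdFamily a μ) {e : σ ⊕ τ → κ}
    (he : Function.Injective e) :
    ∫⁻ ω, (blockNormLE σ τ (2.3 * Fintype.card ι)).indicator
        (fun w => ENNReal.ofReal (Real.exp (-(0.42 * blockGap w)))) (fun j => a (e j) ω) ∂μ ≤
      ENNReal.ofReal (Real.exp (-0.255 * Fintype.card ι) * 101 ^ Fintype.card σ *
        √5 ^ Fintype.card τ) := by
  have hm := h.measurable
  set m : ℝ := (Fintype.card ι : ℝ) with hm_def
  have hm0 : 0 ≤ m := Nat.cast_nonneg _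
  obtain ⟨N, hN1, hNcard, hN⟩ := exists_finset_sphere_net (E := EuclideanSpace ℝ σ)
    (ε := 1 / 50) (by norm_num)
  have hcard : (N.card : ℝ) ≤ 101 ^ Fintype.card σ := by
    refine hNcard.trans (le_of_eq ?_)
    rw [finrank_euclideanSpace]
    norm_num
  have hpt (w : σ ⊕ τ → EuclideanSpace ℝ ι) : (blockNormLE σ τ (2.3 * m)).indicator
        (fun w => ENNReal.ofReal (Real.exp (-(0.42 * blockGap w)))) w ≤
      ENNReal.ofReal (Real.exp (0.00336 * (2.3 * m))) *
        ∑ c ∈ N, expNegSqDist (∑ s, c s • w (Sum.inl s)) (fun t => w (Sum.inr t)) := by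
    by_cases hw : w ∈ blockNormLE σ τ (2.3 * m)
    · rw [Set.indicator_of_mem hw]
      exact ofReal_exp_neg_blockGap_le N hN w hw
    · rw [Set.indicator_of_notMem hw]
      exact zero_le
  obtain ⟨D, hD⟩ : ∃ D : EuclideanSpace ℝ σ → Ω → ℝ≥0∞, ∀ c ω, D c ω =
      expNegSqDist (∑ s, c s • a (e (Sum.inl s)) ω) (fun t => a (e (Sum.inr t)) ω) :=
    ⟨_, fun _ _ => rfl⟩
  have hme (c : EuclideanSpace ℝ σ) : Measurable (D c) := by
    rw [funext (hD c)]
    exact Measurable.expNegSqDist (by fun_prop) (by fun_prop)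
  have hDle (c : EuclideanSpace ℝ σ) (hc : c ∈ N) : ∫⁻ ω, D c ω ∂μ ≤
      ENNReal.ofReal (Real.exp (-0.263 * m) * √5 ^ Fintype.card τ) := by
    simp_rw [hD]
    exact h.lintegral_expNegSqDist_le he (hN1 c hc)
  calc _ ≤ ∫⁻ ω, ENNReal.ofReal (Real.exp (0.00336 * (2.3 * m))) * ∑ c ∈ N, D c ω ∂μ := by
        refine lintegral_mono fun ω => (hpt _).trans (le_of_eq ?_)
        simp_rw [hD]
    _ = ENNReal.ofReal (Real.exp (0.00336 * (2.3 * m))) * ∑ c ∈ N, ∫⁻ ω, D c ω ∂μ := by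
        rw [lintegral_const_mul _ (Finset.measurable_sum _ fun c _ => hme c),
          lintegral_finsetSum _ fun c _ => hme c]
    _ ≤ ENNReal.ofReal (Real.exp (0.00336 * (2.3 * m))) *
        ∑ c ∈ N, ENNReal.ofReal (Real.exp (-0.263 * m) * √5 ^ Fintype.card τ) := by
        gcongr with c hc
        exact hDle c hc
    _ ≤ _ := by
        rw [Finset.sum_const, nsmul_eq_mul, ← ENNReal.ofReal_natCast,
          ← ENNReal.ofReal_mul (Nat.cast_nonneg _), ← ENNReal.ofReal_mul (Real.exp_pos _).le]
        refine ENNReal.ofReal_le_ofReal ?_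
        have h1 : Real.exp (0.00336 * (2.3 * m)) * Real.exp (-0.263 * m) ≤
            Real.exp (-0.255 * m) := by
          rw [← Real.exp_add]
          refine Real.exp_le_exp.2 ?_
          linarith
        calc _ = (Real.exp (0.00336 * (2.3 * m)) * Real.exp (-0.263 * m)) * N.card *
              √5 ^ Fintype.card τ := by ring
          _ ≤ _ := by gcongr

theorem measure_blockNormLE_and_one_lt_le [DecidableEq σ] [DecidableEq τ] [Nonempty σ]
    (h : IsStdFamily a μ) {e : σ ⊕ τ → κ}
    (he : Function.Injective e) {i : κ} (hi : ∀ j, e j ≠ i) :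
    μ {ω | (fun j => a (e j) ω) ∈ blockNormLE σ τ (2.3 * Fintype.card ι) ∧
        1 < ∑ s : σ, inner ℝ (dualFamily (fun j => a (e j) ω) (Sum.inl s)) (a i ω) ^ 2} ≤
      ENNReal.ofReal (2.5 ^ Fintype.card σ * (Real.exp (-0.255 * Fintype.card ι) *
        101 ^ Fintype.card σ * √5 ^ Fintype.card τ)) := by
  have hm := h.measurable
  have hψ : Measurable fun x : Unit → EuclideanSpace ℝ ι => x () := measurable_pi_apply ()
  have hind := (h.indepFun_of_forall_ne e (fun _ : Unit => i) fun j _ => hi j).comp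
    measurable_id hψ
  set G : Set ((σ ⊕ τ → EuclideanSpace ℝ ι) × EuclideanSpace ℝ ι) :=
    {p | 1 < ∑ s : σ, inner ℝ (dualFamily p.1 (Sum.inl s)) p.2 ^ 2} with hG_def
  have hG : MeasurableSet G := by
    refine measurableSet_lt measurable_const (Finset.measurable_sum _ fun s _ => ?_)
    exact (((measurable_dualFamily (Sum.inl s)).comp measurable_fst).inner
      measurable_snd).pow_const 2
  have key := hind.measure_le (μ := μ) (by fun_prop) (by fun_prop)
    (measurableSet_blockNormLE (2.3 * Fintype.card ι)) hG
    (g := fun w => ENNReal.ofReal (2.5 ^ Fintype.card σ) *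
      ENNReal.ofReal (Real.exp (-(0.42 * blockGap w))))
    fun w _ => (h.isStdVector i).measure_one_lt_sum_inner_dualFamily_sq_le w
  refine key.trans ?_
  rw [ENNReal.ofReal_mul (by positivity)]
  refine le_trans (le_of_eq ?_)
    (mul_le_mul_right (h.lintegral_indicator_exp_neg_blockGap_le he) _)
  rw [← lintegral_const_mul' _ _ ENNReal.ofReal_ne_top]
  simp_rw [Set.indicator_const_mul]
  rfl

theorem measure_blockNormLE_and_lt_sum_excess_le [DecidableEq σ] [DecidableEq τ] [Nonempty σ]
    (h : IsStdFamily a μ) {e : σ ⊕ τ → κ} (he : Function.Injective e) {f : θ → κ}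
    (hf : Function.Injective f)
    (hef : ∀ j i, e j ≠ f i) (C : ρ → σ → ℝ) {k : ℝ} (hk : 0 < k)
    (hC : ∑ q, ∑ s, C q s ^ 2 ≤ k) (hkm : 83 * k ≤ Fintype.card ι)
    (hθ : Fintype.card θ * Real.exp (-(0.0336 * Fintype.card ι / k)) ≤ k) :
    μ {ω | (fun j => a (e j) ω) ∈ blockNormLE σ τ (2.3 * Fintype.card ι) ∧
        0.97 * k < ∑ i, max 0 (√(∑ q, (∑ s, C q s *
          inner ℝ (dualFamily (fun j => a (e j) ω) (Sum.inl s)) (a (f i) ω)) ^ 2) - 0.97)} ≤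
      ENNReal.ofReal (Real.exp (0.0336 * Fintype.card ι) * (Real.exp (-0.255 * Fintype.card ι) *
        101 ^ Fintype.card σ * √5 ^ Fintype.card τ)) := by
  have hm := h.measurable
  have hind := h.indepFun_of_forall_ne e f hef
  set G : Set ((σ ⊕ τ → EuclideanSpace ℝ ι) × (θ → EuclideanSpace ℝ ι)) :=
    {p | 0.97 * k < ∑ i, max 0 (√(∑ q, (∑ s, C q s *
          inner ℝ (dualFamily p.1 (Sum.inl s)) (p.2 i)) ^ 2) - 0.97)} with hG_def
  have hG : MeasurableSet G := by
    refine measurableSet_lt measurable_const (Finset.measurable_sum _ fun i _ => ?_)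
    refine measurable_const.max (Measurable.sub_const (Measurable.sqrt ?_) _)
    refine Finset.measurable_sum _ fun q _ => Measurable.pow_const ?_ 2
    refine Finset.measurable_sum _ fun s _ => Measurable.const_mul ?_ _
    exact ((measurable_dualFamily (Sum.inl s)).comp measurable_fst).inner
      ((measurable_pi_apply i).comp measurable_snd)
  have key := hind.measure_le (μ := μ) (by fun_prop) (by fun_prop)
    (measurableSet_blockNormLE (2.3 * Fintype.card ι)) hG
    (g := fun w => ENNReal.ofReal (Real.exp (0.0336 * Fintype.card ι)) *
      ENNReal.ofReal (Real.exp (-(0.42 * blockGap w))))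
    fun w _ => (h.precomp hf).measure_lt_sum_excess_le w C hk hC hkm hθ
  refine key.trans ?_
  rw [ENNReal.ofReal_mul (by positivity)]
  refine le_trans (le_of_eq ?_)
    (mul_le_mul_right (h.lintegral_indicator_exp_neg_blockGap_le he) _)
  rw [← lintegral_const_mul' _ _ ENNReal.ofReal_ne_top]
  simp_rw [Set.indicator_const_mul]

end IsStdFamily

/-! ### The dual certificate -/

/-- A set of `k` elements of `U` carrying the largest values of `g`. -/
theorem Finset.exists_subset_card_eq_forall_le {κ : Type*} (U : Finset κ) (g : κ → ℝ) {k : ℕ}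
    (hk : k ≤ U.card) :
    ∃ T ⊆ U, T.card = k ∧ ∀ i ∈ U, i ∉ T → ∀ j ∈ T, g i ≤ g j := by
  classical
  induction k with
  | zero => exact ⟨∅, by simp, by simp, by simp⟩
  | succ k ih =>
    obtain ⟨T, hTU, hT, hle⟩ := ih (by omega)
    have hne : (U \ T).Nonempty := by
      rw [← Finset.card_pos, Finset.card_sdiff_of_subset hTU]
      omega
    obtain ⟨x, hx, hmax⟩ := Finset.exists_max_image _ g hne
    obtain ⟨hxU, hxT⟩ := Finset.mem_sdiff.1 hx
    refine ⟨insert x T, Finset.insert_subset hxU hTU,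
      by rw [Finset.card_insert_of_notMem hxT, hT], ?_⟩
    intro i hi hiT j hj
    rw [Finset.mem_insert, not_or] at hiT
    rcases Finset.mem_insert.1 hj with rfl | hj
    · exact hmax i (Finset.mem_sdiff.2 ⟨hi, hiT.2⟩)
    · exact hle i hi hiT.2 j hj

/-- If the total excess of the weights `y` over the level `t` is at most `t` times the number of
elements of `T`, and `T` carries the largest values of `g`, then the weighted sum of `g` off `T` is
at most `t` times the whole sum of `g`. -/
theorem sum_mul_le_of_sum_excess_le {κ : Type*} [DecidableEq κ] {U T : Finset κ} (hTU : T ⊆ U)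
    (hT : 0 < T.card) {g y : κ → ℝ} (hg : ∀ i, 0 ≤ g i)
    (htop : ∀ i ∈ U, i ∉ T → ∀ j ∈ T, g i ≤ g j) {t : ℝ}
    (hy : ∑ i ∈ U \ T, max 0 (y i - t) ≤ t * T.card) :
    ∑ i ∈ U \ T, y i * g i ≤ t * ∑ i ∈ U, g i := by
  have hT' : (0 : ℝ) < T.card := by exact_mod_cast hT
  set G := (∑ j ∈ T, g j) / T.card
  have hG0 : 0 ≤ G := div_nonneg (Finset.sum_nonneg fun j _ => hg j) hT'.le
  have hG : ∀ i ∈ U \ T, g i ≤ G := by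
    intro i hi
    rw [Finset.mem_sdiff] at hi
    rw [le_div_iff₀ hT', mul_comm, ← nsmul_eq_mul]
    exact Finset.card_nsmul_le_sum T g _ (htop i hi.1 hi.2)
  calc ∑ i ∈ U \ T, y i * g i ≤ ∑ i ∈ U \ T, (t * g i + max 0 (y i - t) * G) := by
        refine Finset.sum_le_sum fun i hi => ?_
        have h1 : max 0 (y i - t) * g i ≤ max 0 (y i - t) * G :=
          mul_le_mul_of_nonneg_left (hG i hi) (le_max_left _ _)
        have h2 : (y i - t) * g i ≤ max 0 (y i - t) * g i :=
          mul_le_mul_of_nonneg_right (le_max_right _ _) (hg i)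
        linarith
    _ = t * ∑ i ∈ U \ T, g i + (∑ i ∈ U \ T, max 0 (y i - t)) * G := by
        rw [Finset.sum_add_distrib, Finset.mul_sum, Finset.sum_mul]
    _ ≤ t * ∑ i ∈ U \ T, g i + t * T.card * G := by gcongr
    _ = t * ∑ i ∈ U, g i := by
        rw [← Finset.sum_sdiff hTU, mul_add, mul_assoc, mul_div_cancel₀ _ hT'.ne']

section Certificate
variable {ι ι₁ ι₂ κ κ₁ κ₂ ρ : Type*} [Fintype ι] [Fintype ι₁] [Fintype ι₂] [Fintype κ] [Fintype κ₁]
  [Fintype κ₂] [Fintype ρ] [DecidableEq κ] [DecidableEq κ₁] [DecidableEq κ₂]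

/-- For every set `T` of `k` columns away from `S` there is a linear map sending the columns of `M`
indexed by `S` to the standard basis vectors and those indexed by `T` to zero, which maps
every other column into the unit ball; after composition with `C`, the total excess over the level
`0.97` of the norms of these other columns is at most `0.97 * k`. -/
def HasDualCertificate (M : Matrix ι κ ℝ) (S : Finset κ) (C : Matrix ρ κ ℝ) (k : ℕ) : Prop :=
  ∀ T : Finset κ, Disjoint S T → T.card = k → ∃ L : Matrix κ ι ℝ,
    (∀ i ∈ S, ∀ p, (L * M) p i = (1 : Matrix κ κ ℝ) p i) ∧ (∀ i ∈ T, ∀ p, (L * M) p i = 0) ∧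
    (∀ i ∉ S, i ∉ T → ∑ p, (L * M) p i ^ 2 ≤ 1) ∧
    ∑ i ∈ Sᶜ \ T, max 0 (√(∑ q, (C * (L * M)) q i ^ 2) - 0.97) ≤ 0.97 * k

/-- The set `T` of the definition is chosen to carry the `k` largest values of `g` off `S`. -/
theorem HasDualCertificate.exists_map {M : Matrix ι κ ℝ} {S : Finset κ} {C : Matrix ρ κ ℝ} {k : ℕ}
    (h : HasDualCertificate M S C k) (hk : 0 < k) (hcard : k ≤ (Sᶜ).card) {g : κ → ℝ}
    (hg : ∀ i, 0 ≤ g i) : ∃ L : Matrix κ ι ℝ,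
      (∀ i ∈ S, ∀ p, (L * M) p i = (1 : Matrix κ κ ℝ) p i) ∧ (∀ i, ∑ p, (L * M) p i ^ 2 ≤ 1) ∧
      ∑ i ∈ Sᶜ, √(∑ q, (C * (L * M)) q i ^ 2) * g i ≤ 0.97 * ∑ i ∈ Sᶜ, g i := by
  obtain ⟨T, hTU, hT, htop⟩ := Finset.exists_subset_card_eq_forall_le Sᶜ g hcard
  have hST : Disjoint S T := (Finset.disjoint_left.2 fun i hi hiT =>
    (Finset.mem_compl.1 (hTU hiT)) hi)
  obtain ⟨L, hS, hT0, h1, hex⟩ := h T hST hT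
  refine ⟨L, hS, fun i => ?_, ?_⟩
  · by_cases hiS : i ∈ S
    · simp [hS i hiS, Matrix.one_apply]
    · by_cases hiT : i ∈ T
      · simp [hT0 i hiT]
      · exact h1 i hiS hiT
  · rw [← hT] at hex hk
    have := sum_mul_le_of_sum_excess_le hTU hk hg htop hex
    rw [← Finset.sum_sdiff hTU]
    have h0 : ∑ i ∈ T, √(∑ q, (C * (L * M)) q i ^ 2) * g i = 0 := by
      refine Finset.sum_eq_zero fun i hi => ?_
      have : ∀ q, (C * (L * M)) q i = 0 := fun q => by
        rw [Matrix.mul_apply]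
        exact Finset.sum_eq_zero fun p _ => by rw [hT0 i hi p, mul_zero]
      simp [this]
    rw [h0, add_zero]
    exact this

/-- For `H` in the kernel of `H ↦ A H Bᵀ`, the pairing of `H` with `Z` is a fraction of the sum of
the `|H i j|` outside the block `S₁ × S₂`, and `H` vanishes if it is supported in this block. The
matrix `Γ = M₁ᵀ Z M₂` below annihilates `H`, agrees with `Z` on the block, and is bounded in row
`i ∉ S₁` by the norm of column `i` of `Zᵀ M₁`, in column `j ∉ S₂` of the rows `S₁` by the norm of
column `j` of `Z M₂`. -/
theorem abs_sum_mul_le_of_hasDualCertificate {A : Matrix ι₁ κ₁ ℝ} {B : Matrix ι₂ κ₂ ℝ}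
    {S₁ : Finset κ₁} {S₂ : Finset κ₂} {Z : Matrix κ₁ κ₂ ℝ} {k : ℕ}
    (hZ₁ : ∀ i ∉ S₁, ∀ j, Z i j = 0) (hZ₂ : ∀ j ∉ S₂, ∀ i, Z i j = 0)
    (hA : HasDualCertificate A S₁ Zᵀ k) (hB : HasDualCertificate B S₂ Z k) (hk : 0 < k)
    (h₁ : k ≤ (S₁ᶜ).card) (h₂ : k ≤ (S₂ᶜ).card) {H : Matrix κ₁ κ₂ ℝ} (hH : A * H * Bᵀ = 0) :
    |∑ i, ∑ j, Z i j * H i j| ≤ 0.97 * (∑ i ∈ S₁ᶜ, ∑ j, |H i j| + ∑ j ∈ S₂ᶜ, ∑ i ∈ S₁, |H i j|) ∧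
      ((∀ i ∉ S₁, ∀ j, H i j = 0) → (∀ j ∉ S₂, ∀ i, H i j = 0) → H = 0) := by
  obtain ⟨L₁, hS₁, hn₁, hs₁⟩ := hA.exists_map hk h₁ (g := fun i => ∑ j, |H i j|)
    (fun i => Finset.sum_nonneg fun _ _ => abs_nonneg _)
  obtain ⟨L₂, hS₂, hn₂, hs₂⟩ := hB.exists_map hk h₂ (g := fun j => ∑ i ∈ S₁, |H i j|)
    (fun i => Finset.sum_nonneg fun _ _ => abs_nonneg _)
  set M₁ := L₁ * A
  set M₂ := L₂ * B
  have hM : M₁ * H * M₂ᵀ = 0 := by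
    have : M₁ * H * M₂ᵀ = L₁ * (A * H * Bᵀ) * L₂ᵀ := by
      simp only [M₁, M₂, Matrix.transpose_mul, Matrix.mul_assoc]
    rw [this, hH, Matrix.mul_zero, Matrix.zero_mul]
  constructor
  · set Γ := M₁ᵀ * Z * M₂ with hΓ
    have hpair : ∑ i, ∑ j, Γ i j * H i j = 0 := by
      have e1 : ∑ i, ∑ j, Γ i j * H i j = (Γᵀ * H).trace := by
        simp only [Matrix.trace, Matrix.diag, Matrix.mul_apply (M := Γᵀ), Matrix.transpose_apply]
        exact Finset.sum_comm
      rw [e1, hΓ]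
      simp only [Matrix.transpose_mul, Matrix.transpose_transpose]
      have e2 : (M₂ᵀ * (Zᵀ * M₁) * H).trace = (Zᵀ * (M₁ * H * M₂ᵀ)).trace := by
        rw [Matrix.mul_assoc, Matrix.trace_mul_comm]
        simp only [Matrix.mul_assoc]
      rw [e2, hM, Matrix.mul_zero, Matrix.trace_zero]
    have hΓS (i : κ₁) (hi : i ∈ S₁) (j : κ₂) : Γ i j = (Z * M₂) i j := by
      rw [hΓ, Matrix.mul_assoc, Matrix.mul_apply]
      simp [Matrix.transpose_apply, hS₁ i hi, Matrix.one_apply]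
    have hΓSS (i : κ₁) (hi : i ∈ S₁) (j : κ₂) (hj : j ∈ S₂) : Γ i j = Z i j := by
      rw [hΓS i hi, Matrix.mul_apply]
      simp [hS₂ j hj, Matrix.one_apply]
    have hΓ₂ (i : κ₁) (hi : i ∈ S₁) (j : κ₂) : |Γ i j| ≤ √(∑ q, (Z * M₂) q j ^ 2) := by
      rw [hΓS i hi]
      refine Real.abs_le_sqrt ?_
      exact Finset.single_le_sum (f := fun q => (Z * M₂) q j ^ 2) (fun _ _ => sq_nonneg _)
        (Finset.mem_univ i)
    have hΓ₁ (i : κ₁) (j : κ₂) : |Γ i j| ≤ √(∑ q, (Zᵀ * M₁) q i ^ 2) := by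
      have e : Γ i j = ∑ q, (Zᵀ * M₁) q i * M₂ q j := by
        have : (Zᵀ * M₁)ᵀ = M₁ᵀ * Z := by simp [Matrix.transpose_mul]
        rw [hΓ, Matrix.mul_apply]
        refine Finset.sum_congr rfl fun q _ => ?_
        rw [← this, Matrix.transpose_apply]
      rw [e]
      refine Real.abs_le_sqrt ((Finset.sum_mul_sq_le_sq_mul_sq _ _ _).trans ?_)
      exact mul_le_of_le_one_right (Finset.sum_nonneg fun _ _ => sq_nonneg _) (hn₂ j)
    -- the pairing is split into the block, the rows off `S₁`, and the rest of the rows in `S₁`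
    have hsplit : ∑ i, ∑ j, Γ i j * H i j = ∑ i, ∑ j, Z i j * H i j
        + ∑ i ∈ S₁ᶜ, ∑ j, Γ i j * H i j + ∑ j ∈ S₂ᶜ, ∑ i ∈ S₁, Γ i j * H i j := by
      have e1 : ∑ i, ∑ j, Z i j * H i j = ∑ i ∈ S₁, ∑ j ∈ S₂, Γ i j * H i j := by
        rw [← Finset.sum_subset (Finset.subset_univ S₁)
          (fun i _ hi => Finset.sum_eq_zero fun j _ => by rw [hZ₁ i hi, zero_mul])]
        refine Finset.sum_congr rfl fun i hi => ?_
        rw [← Finset.sum_subset (Finset.subset_univ S₂)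
          (fun j _ hj => by rw [hZ₂ j hj, zero_mul])]
        exact Finset.sum_congr rfl fun j hj => by rw [hΓSS i hi j hj]
      rw [e1, Finset.sum_comm (s := S₂ᶜ),
        ← Finset.sum_add_sum_compl S₁ (fun i => ∑ j, Γ i j * H i j)]
      have e2 : ∑ i ∈ S₁, ∑ j, Γ i j * H i j =
          ∑ i ∈ S₁, ∑ j ∈ S₂, Γ i j * H i j + ∑ i ∈ S₁, ∑ j ∈ S₂ᶜ, Γ i j * H i j := by
        rw [← Finset.sum_add_distrib]
        exact Finset.sum_congr rfl fun i _ => (Finset.sum_add_sum_compl S₂ _).symm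
      rw [e2]
      ring
    have b1 : |∑ i ∈ S₁ᶜ, ∑ j, Γ i j * H i j| ≤ 0.97 * ∑ i ∈ S₁ᶜ, ∑ j, |H i j| := by
      refine le_trans ((Finset.abs_sum_le_sum_abs _ _).trans (Finset.sum_le_sum fun i _ => ?_)) hs₁
      rw [Finset.mul_sum]
      refine (Finset.abs_sum_le_sum_abs _ _).trans (Finset.sum_le_sum fun j _ => ?_)
      rw [abs_mul]
      exact mul_le_mul_of_nonneg_right (hΓ₁ i j) (abs_nonneg _)
    have b2 : |∑ j ∈ S₂ᶜ, ∑ i ∈ S₁, Γ i j * H i j| ≤ 0.97 * ∑ j ∈ S₂ᶜ, ∑ i ∈ S₁, |H i j| := by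
      refine le_trans ((Finset.abs_sum_le_sum_abs _ _).trans (Finset.sum_le_sum fun j _ => ?_)) hs₂
      rw [Finset.mul_sum]
      refine (Finset.abs_sum_le_sum_abs _ _).trans (Finset.sum_le_sum fun i hi => ?_)
      rw [abs_mul]
      exact mul_le_mul_of_nonneg_right (hΓ₂ i hi j) (abs_nonneg _)
    rw [hsplit] at hpair
    have e3 : ∑ i, ∑ j, Z i j * H i j =
        -(∑ i ∈ S₁ᶜ, ∑ j, Γ i j * H i j + ∑ j ∈ S₂ᶜ, ∑ i ∈ S₁, Γ i j * H i j) := by linarith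
    rw [e3, abs_neg, mul_add]
    exact (abs_add_le _ _).trans (add_le_add b1 b2)
  · intro hH₁ hH₂
    ext p q
    have e : (M₁ * H * M₂ᵀ) p q = H p q := by
      rw [Matrix.mul_apply]
      have e1 (j : κ₂) : (M₁ * H) p j = H p j := by
        rw [Matrix.mul_apply]
        have : ∀ i, M₁ p i * H i j = (1 : Matrix κ₁ κ₁ ℝ) p i * H i j := fun i => by
          by_cases hi : i ∈ S₁
          · rw [hS₁ i hi]
          · rw [hH₁ i hi, mul_zero, mul_zero]
        simp [this, Matrix.one_apply]
      have : ∀ j, (M₁ * H) p j * M₂ᵀ j q = H p j * (1 : Matrix κ₂ κ₂ ℝ) q j := fun j => by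
        by_cases hj : j ∈ S₂
        · rw [e1, Matrix.transpose_apply, hS₂ j hj]
        · rw [e1, hH₂ j hj, zero_mul, zero_mul]
      rw [Finset.sum_congr rfl fun j _ => this j]
      simp [Matrix.one_apply]
    rw [← e, hM]

end Certificate

/-! ### Perfect recovery -/

section Recovery
variable {m₁ m₂ n₁ n₂ : ℕ} {A : Matrix (Fin m₁) (Fin n₁) ℝ} {B : Matrix (Fin m₂) (Fin n₂) ℝ}
  {X₀ : Matrix (Fin n₁) (Fin n₂) ℝ}

theorem perfectRecovery_of_forall_lt
    (h : ∀ H, A * H * Bᵀ = 0 → H ≠ 0 → matrixL1 X₀ < matrixL1 (X₀ + H)) :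
    PerfectRecovery A B X₀ := by
  have hlt : ∀ X, A * X * Bᵀ = A * X₀ * Bᵀ → X ≠ X₀ → matrixL1 X₀ < matrixL1 X := by
    intro X hX hne
    have := h (X - X₀) (by rw [Matrix.mul_sub, Matrix.sub_mul, hX, sub_self]) (sub_ne_zero.2 hne)
    rwa [add_sub_cancel] at this
  refine Set.eq_singleton_iff_unique_mem.2 ⟨⟨rfl, fun X hX => ?_⟩, fun X hX => ?_⟩
  · by_cases hne : X = X₀
    · rw [hne]
    · exact (hlt X hX hne).le
  · by_contra hne
    exact absurd (hX.2 X₀ rfl) (not_le.2 (hlt X hX.1 hne))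

/-- In this case `H ↦ A H Bᵀ` is injective. -/
theorem perfectRecovery_of_linearIndependent (hA : LinearIndependent ℝ Aᵀ)
    (hB : LinearIndependent ℝ Bᵀ) : PerfectRecovery A B X₀ := by
  refine perfectRecovery_of_forall_lt fun H hH hne => absurd ?_ hne
  have hA' : Function.Injective A.mulVec := Matrix.mulVec_injective_iff.2 hA
  have hB' : Function.Injective B.mulVec := Matrix.mulVec_injective_iff.2 hB
  have h1 : H * Bᵀ = 0 := by
    ext i j
    have : A *ᵥ (fun i => (H * Bᵀ) i j) = A *ᵥ 0 := by
      ext p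
      have := congrFun (congrFun hH p) j
      rw [Matrix.mul_assoc, Matrix.mul_apply] at this
      simpa [Matrix.mulVec, dotProduct] using this
    exact congrFun (hA' this) i
  ext i j
  have : B *ᵥ (fun j => H i j) = B *ᵥ 0 := by
    ext p
    have := congrFun (congrFun h1 i) p
    rw [Matrix.mul_apply] at this
    simpa [Matrix.mulVec, dotProduct, mul_comm] using this
  exact congrFun (hB' this) j

/-- The matrix of the signs of the entries, with `0` for zero entries. -/
noncomputable def signMatrix (X : Matrix (Fin n₁) (Fin n₂) ℝ) : Matrix (Fin n₁) (Fin n₂) ℝ :=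
  fun i j => SignType.sign (X i j)

theorem perfectRecovery_of_hasDualCertificate {S₁ : Finset (Fin n₁)} {S₂ : Finset (Fin n₂)}
    {k : ℕ} (hX₁ : ∀ i ∉ S₁, ∀ j, X₀ i j = 0) (hX₂ : ∀ j ∉ S₂, ∀ i, X₀ i j = 0)
    (hA : HasDualCertificate A S₁ (signMatrix X₀)ᵀ k)
    (hB : HasDualCertificate B S₂ (signMatrix X₀) k) (hk : 0 < k)
    (h₁ : k ≤ (S₁ᶜ).card) (h₂ : k ≤ (S₂ᶜ).card) : PerfectRecovery A B X₀ := by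
  refine perfectRecovery_of_forall_lt fun H hH hne => ?_
  obtain ⟨hle, hzero⟩ := abs_sum_mul_le_of_hasDualCertificate (Z := signMatrix X₀)
    (fun i hi j => by simp [signMatrix, hX₁ i hi j])
    (fun j hj i => by simp [signMatrix, hX₂ j hj i]) hA hB hk h₁ h₂ hH
  -- the part of `H` off the support of `X₀`
  set D : Fin n₁ → Fin n₂ → ℝ := fun i j => if X₀ i j = 0 then |H i j| else 0 with hD
  have hD0 (i j) : 0 ≤ D i j := by
    simp only [hD]; split_ifs <;> simp
  have hpt (i j) : |X₀ i j| + signMatrix X₀ i j * H i j + D i j ≤ |(X₀ + H) i j| := by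
    simp only [hD, signMatrix, Matrix.add_apply]
    rcases lt_trichotomy (X₀ i j) 0 with h | h | h
    · rw [if_neg h.ne, abs_of_neg h, sign_neg h]
      have := neg_le_abs (X₀ i j + H i j)
      rw [SignType.coe_neg, SignType.coe_one]
      linarith
    · simp [h]
    · rw [if_neg h.ne', abs_of_pos h, sign_pos h]
      simpa using le_abs_self (X₀ i j + H i j)
  have hsum : matrixL1 X₀ + ∑ i, ∑ j, signMatrix X₀ i j * H i j + ∑ i, ∑ j, D i j ≤
      matrixL1 (X₀ + H) := by
    simp only [matrixL1, ← Finset.sum_add_distrib]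
    exact Finset.sum_le_sum fun i _ => Finset.sum_le_sum fun j _ => hpt i j
  have hoff : ∑ i ∈ S₁ᶜ, ∑ j, |H i j| + ∑ j ∈ S₂ᶜ, ∑ i ∈ S₁, |H i j| ≤ ∑ i, ∑ j, D i j := by
    rw [← Finset.sum_compl_add_sum S₁, Finset.sum_comm (s := S₂ᶜ)]
    refine add_le_add (Finset.sum_le_sum fun i hi => Finset.sum_le_sum fun j _ => ?_)
      (Finset.sum_le_sum fun i hi => ?_)
    · simp [hD, hX₁ i (Finset.mem_compl.1 hi) j]
    · refine le_trans (Finset.sum_le_sum fun j hj => ?_)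
        (Finset.sum_le_sum_of_subset_of_nonneg (Finset.subset_univ S₂ᶜ) fun j _ _ => hD0 i j)
      simp [hD, hX₂ j (Finset.mem_compl.1 hj) i]
  have hpos : 0 < ∑ i, ∑ j, D i j := by
    have h0 : 0 ≤ ∑ i, ∑ j, D i j :=
      Finset.sum_nonneg fun i _ => Finset.sum_nonneg fun j _ => hD0 i j
    refine h0.lt_of_ne fun hz => hne ?_
    have hDz (i j) : D i j = 0 := by
      have h1 := (Finset.sum_eq_zero_iff_of_nonneg fun i _ =>
        Finset.sum_nonneg fun j _ => hD0 i j).1 hz.symm i (Finset.mem_univ i)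
      exact (Finset.sum_eq_zero_iff_of_nonneg fun j _ => hD0 i j).1 h1 j (Finset.mem_univ j)
    have hHz (i j) (h : X₀ i j = 0) : H i j = 0 := by
      have := hDz i j
      simpa [hD, h] using this
    exact hzero (fun i hi j => hHz i j (hX₁ i hi j)) (fun j hj i => hHz i j (hX₂ j hj i))
  have := neg_abs_le (∑ i, ∑ j, signMatrix X₀ i j * H i j)
  linarith

end Recovery

/-! ### Numerical estimates for the union bound -/

section Numerics

/-- The bound `(e n / k) ^ k` for the binomial coefficient. -/
theorem Nat.choose_le_exp {n k : ℕ} (hk : 0 < k) (hkn : k ≤ n) :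
    (n.choose k : ℝ) ≤ Real.exp (k * Real.log (n / k) + k) := by
  have hk' : (0 : ℝ) < k := by exact_mod_cast hk
  have hn' : (0 : ℝ) < n := by exact_mod_cast hk.trans_le hkn
  have hf : (0 : ℝ) < k.factorial := by exact_mod_cast k.factorial_pos
  have h1 := Nat.choose_le_pow_div (α := ℝ) k n
  have h2 := Real.pow_div_factorial_le_exp (k : ℝ) hk'.le k
  rw [Real.exp_add, mul_comm (k : ℝ) (Real.log _), Real.exp_mul, Real.exp_log (by positivity),
    Real.rpow_natCast]
  refine h1.trans ?_
  have h3 : (n : ℝ) ^ k / k.factorial = (n / k) ^ k * ((k : ℝ) ^ k / k.factorial) := by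
    rw [div_pow]
    field_simp
  rw [h3]
  gcongr

theorem le_log_sixteen : (2.77 : ℝ) ≤ Real.log 16 := by
  have h : (16 : ℝ) = 2 ^ 4 := by norm_num
  rw [h, Real.log_pow]
  have := Real.log_two_gt_d9
  push_cast
  linarith

theorem pow_le_exp_mul {b c : ℝ} (hb : 0 ≤ b) (hbc : b ≤ Real.exp c) (k : ℕ) :
    b ^ k ≤ Real.exp (c * k) := by
  rw [mul_comm, Real.exp_nat_mul]
  exact pow_le_pow_left₀ hb hbc k

theorem hundred_one_le_exp : (101 : ℝ) ≤ Real.exp 4.62 := by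
  rw [← Real.log_le_iff_le_exp (by norm_num)]
  -- `101 = (101 / 100) * (5 / 4) ^ 2 * 2 ^ 6`
  have h1 : Real.log (101 / 100 * (5 / 4) ^ 2 * 2 ^ 6) = Real.log 101 := by norm_num
  rw [← h1, Real.log_mul (by norm_num) (by norm_num), Real.log_mul (by norm_num) (by norm_num),
    Real.log_pow, Real.log_pow]
  have h2 := Real.log_le_sub_one_of_pos (show (0 : ℝ) < 101 / 100 by norm_num)
  have h3 : Real.log (5 / 4) ≤ 0.2235 := by
    rw [Real.log_le_iff_le_exp (by norm_num)]
    refine le_trans ?_ (Real.taylor_five_le_exp 0.2235)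
    norm_num
  have := Real.log_two_lt_d9
  push_cast
  linarith

theorem sqrt_five_le_exp : √5 ≤ Real.exp 0.81 := by
  rw [Real.sqrt_le_left (Real.exp_pos _).le, ← Real.exp_nat_mul]
  have h := pow_le_pow_left₀ (by norm_num) (Real.taylor_five_le_exp 0.81) 2
  rw [← Real.exp_nat_mul] at h
  refine le_trans ?_ h
  norm_num

theorem two_point_five_le_exp : (2.5 : ℝ) ≤ Real.exp 0.92 := by
  refine le_trans ?_ (Real.taylor_five_le_exp 0.92)
  norm_num

/-- For `k = 1` the left-hand side is `n²`; for `k ≥ 2` the factor `n` costs at most half as much as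
the binomial coefficient, up to terms of order `k`. -/
theorem mul_choose_le_exp {n k : ℕ} {m : ℝ} (hk : 0 < k) (hkn : 16 * k ≤ n)
    (hm : 30 * (k * Real.log (n / k)) ≤ m) :
    n * (n.choose k : ℝ) ≤ Real.exp (0.0667 * m) := by
  have hk' : (0 : ℝ) < k := by exact_mod_cast hk
  have hn' : (0 : ℝ) < n := by exact_mod_cast (by omega : 0 < n)
  have hx : (16 : ℝ) ≤ n / k := by
    rw [le_div_iff₀ hk']; exact_mod_cast hkn
  have hlog : 2.77 ≤ Real.log (n / k) :=
    le_log_sixteen.trans (Real.log_le_log (by norm_num) hx)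
  rcases Nat.lt_or_ge k 2 with h2 | h2
  · have : k = 1 := by omega
    subst this
    rw [Nat.choose_one_right, ← sq, ← Real.exp_log hn', ← Real.exp_nat_mul]
    refine Real.exp_le_exp.2 ?_
    simp only [Nat.cast_one, div_one, one_mul] at hm hlog
    push_cast
    linarith
  · have h2' : (2 : ℝ) ≤ k := by exact_mod_cast h2
    have e : (n : ℝ) = Real.exp (Real.log k + Real.log (n / k)) := by
      rw [Real.exp_add, Real.exp_log hk', Real.exp_log (by positivity)]
      field_simp
    have h3 := Nat.choose_le_exp hk (by omega : k ≤ n)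
    have hlogk : Real.log k ≤ 0.37 * k := by
      have h4 := Real.log_le_sub_one_of_pos (show 0 < (k : ℝ) / Real.exp 1 by positivity)
      rw [Real.log_div hk'.ne' (Real.exp_pos 1).ne', Real.log_exp] at h4
      have h5 : (k : ℝ) / Real.exp 1 ≤ 0.37 * k := by
        rw [div_le_iff₀ (Real.exp_pos 1)]
        have := Real.exp_one_gt_d9
        nlinarith
      linarith
    calc n * (n.choose k : ℝ)
        ≤ Real.exp (Real.log k + Real.log (n / k)) * Real.exp (k * Real.log (n / k) + k) := by
          rw [← e]; gcongr
      _ = Real.exp (Real.log k + Real.log (n / k) + (k * Real.log (n / k) + k)) := by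
          rw [← Real.exp_add]
      _ ≤ _ := by
          refine Real.exp_le_exp.2 ?_
          have h6 : 2 * Real.log (n / k) ≤ k * Real.log (n / k) := by gcongr
          have h7 : k * 2.77 ≤ k * Real.log (n / k) := by gcongr
          linarith

/-- The sum of the bounds for the exceptional events: a large norm of the columns in the support,
and, for each of the `n.choose k` sets `T`, a linear dependence, one of `n` columns mapped outside
the unit ball, or a large total excess. Each of the four sums is at most `exp (-0.11 m)`. -/
theorem sum_failure_le {n k s : ℕ} {m : ℝ} (hk : 0 < k) (hkn : 16 * k ≤ n) (hs : s ≤ k)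
    (hm : 30 * (k * Real.log (n / k)) ≤ m) :
    101 ^ s * Real.exp (-0.2 * m) + n.choose k * (Real.exp (-0.263 * m) * √5 ^ (s + k) +
      n * (2.5 ^ s * (Real.exp (-0.255 * m) * 101 ^ s * √5 ^ k)) +
      Real.exp (0.0336 * m) * (Real.exp (-0.255 * m) * 101 ^ s * √5 ^ k)) ≤
    2 * Real.exp (-0.1 * m) := by
  have hk' : (1 : ℝ) ≤ k := by exact_mod_cast hk
  have hx : (16 : ℝ) ≤ n / k := by
    rw [le_div_iff₀ (by linarith)]; exact_mod_cast hkn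
  have hlog : 2.77 ≤ Real.log (n / k) :=
    le_log_sixteen.trans (Real.log_le_log (by norm_num) hx)
  have hkm : 83.1 * k ≤ m := by
    have : k * 2.77 ≤ k * Real.log (n / k) := by gcongr
    linarith
  have h5 : 1 ≤ √5 := by rw [Real.one_le_sqrt]; norm_num
  have a1 : (101 : ℝ) ^ s ≤ Real.exp (4.62 * k) :=
    (pow_le_pow_right₀ (by norm_num) hs).trans (pow_le_exp_mul (by norm_num) hundred_one_le_exp k)
  have a2 : (2.5 : ℝ) ^ s ≤ Real.exp (0.92 * k) :=
    (pow_le_pow_right₀ (by norm_num) hs).trans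
      (pow_le_exp_mul (by norm_num) two_point_five_le_exp k)
  have a3 : √5 ^ k ≤ Real.exp (0.81 * k) := pow_le_exp_mul (by positivity) sqrt_five_le_exp k
  have a4 : √5 ^ (s + k) ≤ Real.exp (0.81 * k) * Real.exp (0.81 * k) := by
    rw [pow_add]
    exact mul_le_mul ((pow_le_pow_right₀ h5 hs).trans a3) a3 (by positivity) (Real.exp_pos _).le
  have hc : (n.choose k : ℝ) ≤ Real.exp (m / 30 + k) :=
    (Nat.choose_le_exp hk (by omega)).trans (Real.exp_le_exp.2 (by linarith))
  have hnc := mul_choose_le_exp hk hkn hm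
  have t1 : 101 ^ s * Real.exp (-0.2 * m) ≤ Real.exp (-0.11 * m) := by
    calc _ ≤ Real.exp (4.62 * k) * Real.exp (-0.2 * m) := by gcongr
      _ = Real.exp (4.62 * k + -0.2 * m) := by rw [Real.exp_add]
      _ ≤ _ := Real.exp_le_exp.2 (by linarith)
  have t2 : n.choose k * (Real.exp (-0.263 * m) * √5 ^ (s + k)) ≤ Real.exp (-0.11 * m) := by
    calc _ ≤ Real.exp (m / 30 + k) * (Real.exp (-0.263 * m) *
          (Real.exp (0.81 * k) * Real.exp (0.81 * k))) := by gcongr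
      _ = Real.exp (m / 30 + k + (-0.263 * m + (0.81 * k + 0.81 * k))) := by
          simp only [Real.exp_add]
      _ ≤ _ := Real.exp_le_exp.2 (by linarith)
  have t3 : n.choose k * (n * (2.5 ^ s * (Real.exp (-0.255 * m) * 101 ^ s * √5 ^ k))) ≤
      Real.exp (-0.11 * m) := by
    calc _ = (n * n.choose k) * (2.5 ^ s * (Real.exp (-0.255 * m) * 101 ^ s * √5 ^ k)) := by ring
      _ ≤ Real.exp (0.0667 * m) * (Real.exp (0.92 * k) * (Real.exp (-0.255 * m) *
          Real.exp (4.62 * k) * Real.exp (0.81 * k))) := by gcongr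
      _ = Real.exp (0.0667 * m + (0.92 * k + (-0.255 * m + 4.62 * k + 0.81 * k))) := by
          simp only [Real.exp_add]
      _ ≤ _ := Real.exp_le_exp.2 (by linarith)
  have t4 : n.choose k * (Real.exp (0.0336 * m) * (Real.exp (-0.255 * m) * 101 ^ s * √5 ^ k)) ≤
      Real.exp (-0.11 * m) := by
    calc _ ≤ Real.exp (m / 30 + k) * (Real.exp (0.0336 * m) * (Real.exp (-0.255 * m) *
          Real.exp (4.62 * k) * Real.exp (0.81 * k))) := by gcongr
      _ = Real.exp (m / 30 + k + (0.0336 * m + (-0.255 * m + 4.62 * k + 0.81 * k))) := by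
          simp only [Real.exp_add]
      _ ≤ _ := Real.exp_le_exp.2 (by linarith)
  have t5 : Real.exp (-0.11 * m) ≤ 1 / 2 * Real.exp (-0.1 * m) := by
    have e : Real.exp (-0.11 * m) = Real.exp (-0.01 * m) * Real.exp (-0.1 * m) := by
      rw [← Real.exp_add]; congr 1; ring
    have h8 : Real.exp (-0.01 * m) ≤ 1 / 2 := by
      have h9 : Real.exp (-0.01 * m) ≤ Real.exp (-Real.log 2) := by
        refine Real.exp_le_exp.2 ?_
        have := Real.log_two_lt_d9
        linarith
      rw [Real.exp_neg, Real.exp_log two_pos] at h9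
      linarith
    rw [e]
    gcongr
  rw [mul_add, mul_add]
  linarith

end Numerics

/-! ### Existence of the certificate -/

/-- The matrix with columns `v j`. -/
def columnMatrix {ι κ : Type*} (v : κ → EuclideanSpace ℝ ι) : Matrix ι κ ℝ :=
  Matrix.of fun i j => v j i

/-- The elements of two finsets `S` and `T`, indexed by the two blocks of `S ⊕ T`. -/
def blockIndex {κ : Type*} (S T : Finset κ) : S ⊕ T → κ := Sum.elim (↑) (↑)

theorem blockIndex_injective {κ : Type*} {S T : Finset κ} (hST : Disjoint S T) :
    Function.Injective (blockIndex S T) :=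
  Function.Injective.sumElim Subtype.val_injective Subtype.val_injective
    fun s t hst => Finset.disjoint_left.1 hST s.2 (hst ▸ t.2)

section DualCertificate
variable {ι κ ρ : Type*} [Fintype ι] [Fintype κ] [Fintype ρ] [DecidableEq κ]

/-- The linear map of the certificate has as rows the dual vectors of the columns indexed by `S`,
within the family of the columns indexed by `S ∪ T`, and zero rows outside `S`. -/
theorem hasDualCertificate_of_forall (v : κ → EuclideanSpace ℝ ι) (S : Finset κ)
    (C : Matrix ρ κ ℝ) (k : ℕ) (h : ∀ T : Finset κ, Disjoint S T → T.card = k →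
      LinearIndepOn ℝ v ((S ∪ T : Finset κ) : Set κ) ∧
      (∀ i ∉ S, i ∉ T →
        ∑ s : S, inner ℝ (dualFamily (v ∘ blockIndex S T) (Sum.inl s)) (v i) ^ 2 ≤ 1) ∧
      ∑ i : (Sᶜ \ T : Finset κ), max 0 (√(∑ q, (∑ s : S, C q s *
          inner ℝ (dualFamily (v ∘ blockIndex S T) (Sum.inl s)) (v i)) ^ 2) - 0.97) ≤ 0.97 * k) :
    HasDualCertificate (columnMatrix v) S C k := by
  intro T hST hT
  obtain ⟨hli, h1, h2⟩ := h T hST hT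
  set w := v ∘ blockIndex S T with hw
  have hwli : LinearIndependent ℝ w := by
    have hmem (j : S ⊕ T) : blockIndex S T j ∈ ((S ∪ T : Finset κ) : Set κ) := by
      rcases j with s | t
      · exact Finset.mem_coe.2 (Finset.mem_union_left _ s.2)
      · exact Finset.mem_coe.2 (Finset.mem_union_right _ t.2)
    exact LinearIndependent.comp hli (fun j => ⟨blockIndex S T j, hmem j⟩)
      fun i j hij => blockIndex_injective hST (congrArg Subtype.val hij)
  set L : Matrix κ ι ℝ := Matrix.of fun p i =>
    if hp : p ∈ S then dualFamily w (Sum.inl ⟨p, hp⟩) i else 0 with hL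
  have hLM (p i : κ) : (L * columnMatrix v) p i =
      if hp : p ∈ S then inner ℝ (dualFamily w (Sum.inl ⟨p, hp⟩)) (v i) else 0 := by
    rw [Matrix.mul_apply]
    by_cases hp : p ∈ S
    · simp [hL, columnMatrix, hp, PiLp.inner_apply, mul_comm]
    · simp [hL, hp]
  have hsum (F : κ → ℝ → ℝ) (hF : ∀ p, F p 0 = 0) (i : κ) : ∑ p, F p ((L * columnMatrix v) p i) =
      ∑ s : S, F s (inner ℝ (dualFamily w (Sum.inl s)) (v i)) := by
    rw [← Finset.sum_subset (Finset.subset_univ S) fun p _ hp => by rw [hLM, dif_neg hp, hF],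
      ← Finset.sum_coe_sort S]
    refine Finset.sum_congr rfl fun s _ => ?_
    rw [hLM, dif_pos s.2]
  refine ⟨L, fun i hi p => ?_, fun i hi p => ?_, fun i hiS hiT => ?_, ?_⟩
  · rw [hLM]
    have e : v i = w (Sum.inl ⟨i, hi⟩) := rfl
    split_ifs with hp
    · rw [e, inner_dualFamily hwli]
      simp [Matrix.one_apply, Subtype.ext_iff]
    · rw [Matrix.one_apply_ne]
      rintro rfl
      exact hp hi
  · rw [hLM]
    have e : v i = w (Sum.inr ⟨i, hi⟩) := rfl
    split_ifs with hp
    · rw [e, inner_dualFamily hwli]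
      simp
    · rfl
  · rw [hsum (fun _ x => x ^ 2) (by simp)]
    exact h1 i hiS hiT
  · rw [← Finset.sum_coe_sort]
    refine le_trans (le_of_eq ?_) h2
    refine Finset.sum_congr rfl fun i _ => ?_
    congr 3
    refine Finset.sum_congr rfl fun q _ => ?_
    rw [Matrix.mul_apply, hsum (fun p x => C q p * x) (by simp)]

end DualCertificate

namespace IsStdFamily
variable {Ω ι κ ρ : Type*} [MeasurableSpace Ω] {μ : Measure Ω} [IsProbabilityMeasure μ]
  {a : κ → Ω → EuclideanSpace ℝ ι} [Fintype ι] [Fintype κ] [Fintype ρ] [DecidableEq κ]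

theorem measure_not_hasDualCertificate_le (h : IsStdFamily a μ) {S : Finset κ} (hS : S.Nonempty)
    {k : ℕ} (hSk : S.card ≤ k) (C : Matrix ρ κ ℝ) (hC : ∑ q, ∑ s ∈ S, C q s ^ 2 ≤ k)
    (hkn : 16 * k ≤ Fintype.card κ)
    (hm : 30 * (k * Real.log (Fintype.card κ / k)) ≤ Fintype.card ι) :
    μ {ω | ¬ HasDualCertificate (columnMatrix fun j => a j ω) S C k} ≤
      ENNReal.ofReal (2 * Real.exp (-0.1 * Fintype.card ι)) := by
  have hk : 0 < k := hS.card_pos.trans_le hSk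
  have hk' : (0 : ℝ) < k := by exact_mod_cast hk
  have : Nonempty S := hS.to_subtype
  set m : ℝ := (Fintype.card ι : ℝ) with hm_def
  set n := Fintype.card κ with hn_def
  have hx : (16 : ℝ) ≤ n / k := by
    rw [le_div_iff₀ hk']; exact_mod_cast hkn
  have hkm : 83 * (k : ℝ) ≤ m := by
    have : k * 2.77 ≤ k * Real.log (n / k) := by
      gcongr
      exact le_log_sixteen.trans (Real.log_le_log (by norm_num) hx)
    linarith
  have hθ : n * Real.exp (-(0.0336 * m / k)) ≤ k := by
    have h1 : Real.log (n / k) ≤ 0.0336 * m / k := by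
      rw [le_div_iff₀ hk']
      have : 0 ≤ m := Nat.cast_nonneg _
      linarith
    have h2 : Real.exp (-(0.0336 * m / k)) ≤ (n / k : ℝ)⁻¹ := by
      rw [← Real.exp_log (show (0 : ℝ) < n / k by linarith), ← Real.exp_neg]
      exact Real.exp_le_exp.2 (neg_le_neg h1)
    have hn0 : (n : ℝ) ≠ 0 := by
      rintro h0
      rw [h0] at hx
      norm_num at hx
    calc n * Real.exp (-(0.0336 * m / k)) ≤ n * (n / k : ℝ)⁻¹ := by gcongr
      _ = k := by field_simp
  -- the exceptional events: a large norm of the columns in `S`; linear dependence; a column mapped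
  -- outside the unit ball; a large total excess
  set E₀ : Set Ω := {ω | ∃ ζ : S → ℝ, 2.3 * m * ∑ s, ζ s ^ 2 < ‖∑ s, ζ s • a (s : κ) ω‖ ^ 2}
  set E₁ : Finset κ → Set Ω := fun T =>
    {ω | ¬ LinearIndepOn ℝ (fun j => a j ω) ((S ∪ T : Finset κ) : Set κ)}
  set E₂ : Finset κ → κ → Set Ω := fun T i =>
    {ω | (fun j => a (blockIndex S T j) ω) ∈ blockNormLE S T (2.3 * m) ∧
      1 < ∑ s : S, inner ℝ (dualFamily (fun j => a (blockIndex S T j) ω) (Sum.inl s)) (a i ω) ^ 2}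
  set E₃ : Finset κ → Set Ω := fun T =>
    {ω | (fun j => a (blockIndex S T j) ω) ∈ blockNormLE S T (2.3 * m) ∧
      0.97 * k < ∑ i : (Sᶜ \ T : Finset κ), max 0 (√(∑ q, (∑ s : S, C q s *
        inner ℝ (dualFamily (fun j => a (blockIndex S T j) ω) (Sum.inl s)) (a i ω)) ^ 2) - 0.97)}
  set 𝒯 := Finset.powersetCard k (Sᶜ : Finset κ)
  have hsub : {ω | ¬ HasDualCertificate (columnMatrix fun j => a j ω) S C k} ⊆
      E₀ ∪ ⋃ T ∈ 𝒯, (E₁ T ∪ (⋃ i ∈ Sᶜ \ T, E₂ T i)) ∪ E₃ T := by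
    intro ω hω
    by_contra hcon
    refine hω (hasDualCertificate_of_forall _ _ _ _ fun T hST hT => ?_)
    have hTmem : T ∈ 𝒯 := Finset.mem_powersetCard.2
      ⟨fun i hi => Finset.mem_compl.2 fun hiS => Finset.disjoint_left.1 hST hiS hi, hT⟩
    simp only [Set.mem_union, Set.mem_iUnion, not_or, not_exists] at hcon
    obtain ⟨h0, h123⟩ := hcon
    obtain ⟨⟨h1, h2⟩, h3⟩ := h123 T hTmem
    have hK : (fun j => a (blockIndex S T j) ω) ∈ blockNormLE S T (2.3 * m) := by
      intro ζ
      by_contra hlt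
      exact h0 ⟨ζ, not_le.1 hlt⟩
    refine ⟨not_not.1 h1, fun i hiS hiT => ?_, ?_⟩
    · by_contra hlt
      exact h2 i (by simp [hiS, hiT]) ⟨hK, not_le.1 hlt⟩
    · by_contra hlt
      exact h3 ⟨hK, not_le.1 hlt⟩
  have h0 : μ E₀ ≤ ENNReal.ofReal (101 ^ S.card * Real.exp (-0.2 * m)) := by
    have := h.measure_exists_norm_sq_gt_le (e := fun s : S => (s : κ)) Subtype.val_injective
    rwa [Fintype.card_coe] at this
  have hT (T : Finset κ) (hT : T ∈ 𝒯) : μ (E₁ T ∪ (⋃ i ∈ Sᶜ \ T, E₂ T i) ∪ E₃ T) ≤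
      ENNReal.ofReal (Real.exp (-0.263 * m) * √5 ^ (S.card + k) +
      n * (2.5 ^ S.card * (Real.exp (-0.255 * m) * 101 ^ S.card * √5 ^ k)) +
      Real.exp (0.0336 * m) * (Real.exp (-0.255 * m) * 101 ^ S.card * √5 ^ k)) := by
    obtain ⟨hTS, hTk⟩ := Finset.mem_powersetCard.1 hT
    have hST : Disjoint S T := Finset.disjoint_left.2 fun i hi hiT =>
      Finset.mem_compl.1 (hTS hiT) hi
    have hne (i : κ) (hi : i ∈ Sᶜ \ T) (j : S ⊕ T) : blockIndex S T j ≠ i := by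
      rintro rfl
      simp only [Finset.mem_sdiff, Finset.mem_compl] at hi
      rcases j with s | t
      · exact hi.1 s.2
      · exact hi.2 t.2
    have b1 : μ (E₁ T) ≤ ENNReal.ofReal (Real.exp (-0.263 * m) * √5 ^ (S.card + k)) := by
      have := h.measure_not_linearIndepOn_le (S ∪ T)
      rwa [Finset.card_union_of_disjoint hST, hTk] at this
    have b2 : μ (⋃ i ∈ Sᶜ \ T, E₂ T i) ≤ ENNReal.ofReal
        (n * (2.5 ^ S.card * (Real.exp (-0.255 * m) * 101 ^ S.card * √5 ^ k))) := by
      calc _ ≤ ∑ i ∈ Sᶜ \ T, μ (E₂ T i) := measure_biUnion_finset_le _ _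
        _ ≤ ∑ i ∈ Sᶜ \ T, ENNReal.ofReal
            (2.5 ^ S.card * (Real.exp (-0.255 * m) * 101 ^ S.card * √5 ^ k)) := by
          refine Finset.sum_le_sum fun i hi => ?_
          have := h.measure_blockNormLE_and_one_lt_le (blockIndex_injective hST) (hne i hi)
          rwa [Fintype.card_coe, Fintype.card_coe, hTk] at this
        _ ≤ _ := by
          rw [Finset.sum_const, nsmul_eq_mul, ENNReal.ofReal_mul (Nat.cast_nonneg n),
            ENNReal.ofReal_natCast]
          gcongr
          exact Finset.card_le_univ _
    have b3 : μ (E₃ T) ≤ ENNReal.ofReal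
        (Real.exp (0.0336 * m) * (Real.exp (-0.255 * m) * 101 ^ S.card * √5 ^ k)) := by
      have := h.measure_blockNormLE_and_lt_sum_excess_le (blockIndex_injective hST)
        (f := fun i : (Sᶜ \ T : Finset κ) => (i : κ)) Subtype.val_injective
        (fun j i => hne i i.2 j) (fun q s => C q s) hk' (by
          refine le_trans (le_of_eq ?_) hC
          exact Finset.sum_congr rfl fun q _ => Finset.sum_coe_sort S fun s => C q s ^ 2) hkm (by
          refine le_trans ?_ hθ
          gcongr
          rw [Fintype.card_coe]
          exact Finset.card_le_univ _)
      rwa [Fintype.card_coe, Fintype.card_coe, hTk] at this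
    refine (measure_union_le _ _).trans ?_
    rw [ENNReal.ofReal_add (by positivity) (by positivity),
      ENNReal.ofReal_add (by positivity) (by positivity)]
    exact add_le_add ((measure_union_le _ _).trans (add_le_add b1 b2)) b3
  have hcard : 𝒯.card ≤ n.choose k := by
    rw [Finset.card_powersetCard]
    exact Nat.choose_le_choose k (Finset.card_le_univ _)
  calc _ ≤ _ := measure_mono hsub
    _ ≤ _ := measure_union_le _ _
    _ ≤ _ := add_le_add h0 ((measure_biUnion_finset_le _ _).trans (Finset.sum_le_sum hT))
    _ ≤ ENNReal.ofReal (2 * Real.exp (-0.1 * m)) := by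
      rw [Finset.sum_const, nsmul_eq_mul, ← ENNReal.ofReal_natCast,
        ← ENNReal.ofReal_mul (Nat.cast_nonneg _),
        ← ENNReal.ofReal_add (by positivity) (by positivity)]
      refine ENNReal.ofReal_le_ofReal (le_trans ?_ (sum_failure_le hk hkn hSk hm))
      gcongr

end IsStdFamily

/-! ### Normalization of the entries -/

section Scaling
variable {Ω : Type*} [MeasurableSpace Ω] {μ : Measure Ω}

theorem IsStrictlySubGaussian.const_mul {X : Ω → ℝ} {v w : ℝ≥0} (h : IsStrictlySubGaussian X v μ)
    {c : ℝ} (hc : c ^ 2 * v = w) : IsStrictlySubGaussian (fun ω => c * X ω) w μ where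
  mean_eq_zero := by rw [integral_const_mul, h.mean_eq_zero, mul_zero]
  second_moment := by
    simp_rw [mul_pow]
    rw [integral_const_mul, h.second_moment, hc]
  mgf_bound := by
    have := h.mgf_bound.const_mul c
    convert this using 1
    exact NNReal.eq hc.symm

theorem isStdFamily_of_entries {ι κ : Type*} {ξ : κ → ι → Ω → ℝ}
    (hmeas : ∀ j i, Measurable (ξ j i)) (hindep : iIndepFun (fun (p : κ × ι) => ξ p.1 p.2) μ)
    {v : ℝ≥0} (hsub : ∀ j i, IsStrictlySubGaussian (ξ j i) v μ) {c : ℝ} (hc : c ^ 2 * v = 1) :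
    IsStdFamily (fun j ω => (WithLp.toLp 2 fun i => c * ξ j i ω : EuclideanSpace ℝ ι)) μ where
  measurable j := by
    have := hmeas j
    fun_prop
  indep := hindep.comp (fun _ x => c * x) (fun _ => by fun_prop)
  subGaussian j i := (hsub j i).const_mul hc

variable {m₁ m₂ n₁ n₂ : ℕ} {A : Matrix (Fin m₁) (Fin n₁) ℝ} {B : Matrix (Fin m₂) (Fin n₂) ℝ}
  {X₀ : Matrix (Fin n₁) (Fin n₂) ℝ}

/-- Rescaling the measurement matrices changes neither the feasible set nor the objective. -/
theorem PerfectRecovery.of_smul {c : ℝ} (hc : c ≠ 0) (h : PerfectRecovery (c • A) (c • B) X₀) :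
    PerfectRecovery A B X₀ := by
  have key (X : Matrix (Fin n₁) (Fin n₂) ℝ) : (c • A) * X * (c • B)ᵀ = (c • A) * X₀ * (c • B)ᵀ ↔
      A * X * Bᵀ = A * X₀ * Bᵀ := by
    simp only [Matrix.transpose_smul, Matrix.smul_mul, Matrix.mul_smul]
    rw [smul_right_inj hc, smul_right_inj hc]
  unfold PerfectRecovery kcsSolutions at h ⊢
  simpa only [key] using h

end Scaling

/-! ### The support of a matrix -/

section Support
variable {n₁ n₂ : ℕ} (X : Matrix (Fin n₁) (Fin n₂) ℝ)

theorem matrixL0_transpose : matrixL0 Xᵀ = matrixL0 X := by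
  unfold matrixL0
  rw [← Set.ncard_image_of_injective _ (Prod.swap_injective)]
  congr 1
  ext ⟨i, j⟩
  simp [Set.image_swap_eq_preimage_swap]

/-- The rows of `X` with a nonzero entry. -/
noncomputable def rowSupport : Finset (Fin n₁) :=
  open scoped Classical in Finset.univ.filter fun i => ∃ j, X i j ≠ 0

theorem mem_rowSupport {i : Fin n₁} : i ∈ rowSupport X ↔ ∃ j, X i j ≠ 0 := by
  simp [rowSupport]

theorem eq_zero_of_notMem_rowSupport {i : Fin n₁} (hi : i ∉ rowSupport X) (j : Fin n₂) :
    X i j = 0 :=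
  by_contra fun h => hi ((mem_rowSupport X).2 ⟨j, h⟩)

theorem matrixL0_eq_card :
    matrixL0 X = (Finset.univ.filter fun e : Fin n₁ × Fin n₂ => X e.1 e.2 ≠ 0).card := by
  rw [matrixL0, ← Set.ncard_coe_finset]
  congr 1
  ext e
  simp

theorem card_rowSupport_le : (rowSupport X).card ≤ matrixL0 X := by
  rw [matrixL0_eq_card]
  refine le_trans (Finset.card_le_card (t := (Finset.univ.filter
    fun e : Fin n₁ × Fin n₂ => X e.1 e.2 ≠ 0).image Prod.fst) fun i hi => ?_) Finset.card_image_le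
  obtain ⟨j, hj⟩ := (mem_rowSupport X).1 hi
  exact Finset.mem_image.2 ⟨(i, j), by simpa using hj, rfl⟩

theorem rowSupport_nonempty (h : 0 < matrixL0 X) : (rowSupport X).Nonempty := by
  rw [matrixL0_eq_card, Finset.card_pos] at h
  obtain ⟨e, he⟩ := h
  exact ⟨e.1, (mem_rowSupport X).2 ⟨e.2, (Finset.mem_filter.1 he).2⟩⟩

theorem sum_signMatrix_sq : ∑ i, ∑ j, signMatrix X i j ^ 2 = (matrixL0 X : ℝ) := by
  rw [matrixL0_eq_card, Finset.card_filter, ← Finset.univ_product_univ, Finset.sum_product]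
  push_cast
  refine Finset.sum_congr rfl fun i _ => Finset.sum_congr rfl fun j _ => ?_
  rcases lt_trichotomy (X i j) 0 with h | h | h
  · simp [signMatrix, h, h.ne]
  · simp [signMatrix, h]
  · simp [signMatrix, h, h.ne']

theorem matrixL1_pos (h : X ≠ 0) : 0 < matrixL1 X := by
  have h0 : 0 ≤ matrixL1 X :=
    Finset.sum_nonneg fun i _ => Finset.sum_nonneg fun j _ => abs_nonneg _
  refine h0.lt_of_ne fun hz => h ?_
  ext i j
  have h1 := (Finset.sum_eq_zero_iff_of_nonneg fun i _ =>
    Finset.sum_nonneg fun j _ => abs_nonneg (X i j)).1 hz.symm i (Finset.mem_univ i)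
  exact abs_eq_zero.1
    ((Finset.sum_eq_zero_iff_of_nonneg fun j _ => abs_nonneg (X i j)).1 h1 j (Finset.mem_univ j))

end Support

/-! ### Recovery with high probability -/

/-- By concavity it suffices to compare at the endpoints. -/
theorem div_six_le_log {x : ℝ} (h2 : 2 ≤ x) (h16 : x ≤ 16) : x / 6 ≤ Real.log x := by
  have h := strictConcaveOn_log_Ioi.concaveOn.2 (show (2 : ℝ) ∈ Set.Ioi 0 by simp)
    (show (16 : ℝ) ∈ Set.Ioi 0 by simp) (show 0 ≤ (16 - x) / 14 by linarith)
    (show 0 ≤ (x - 2) / 14 by linarith) (by ring)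
  simp only [smul_eq_mul] at h
  have e : (16 - x) / 14 * 2 + (x - 2) / 14 * 16 = x := by ring
  rw [e] at h
  have h1 := Real.log_two_gt_d9
  have h3 := le_log_sixteen
  nlinarith

section FewColumns
variable {Ω ι κ : Type*} [MeasurableSpace Ω] {μ : Measure Ω} [IsProbabilityMeasure μ]
  {a : κ → Ω → EuclideanSpace ℝ ι} [Fintype ι] [Fintype κ]

/-- If there are at least five times as many rows as columns, the random matrix is injective with
high probability. -/
theorem IsStdFamily.measure_not_linearIndependent_le (h : IsStdFamily a μ)
    (hm : 5 * (Fintype.card κ : ℝ) ≤ Fintype.card ι) :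
    μ {ω | ¬ LinearIndependent ℝ (columnMatrix fun j => a j ω)ᵀ} ≤
      ENNReal.ofReal (2 * Real.exp (-0.1 * Fintype.card ι)) := by
  have hsub : {ω | ¬ LinearIndependent ℝ (columnMatrix fun j => a j ω)ᵀ} ⊆
      {ω | ¬ LinearIndepOn ℝ (fun j => a j ω) ((Finset.univ : Finset κ) : Set κ)} := by
    intro ω hω hli
    rw [Finset.coe_univ, linearIndepOn_univ_iff] at hli
    exact hω (hli.map' (WithLp.linearEquiv 2 ℝ (ι → ℝ)).toLinearMap
      (LinearEquiv.ker _))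
  refine (measure_mono hsub).trans ((h.measure_not_linearIndepOn_le _).trans ?_)
  refine ENNReal.ofReal_le_ofReal ?_
  rw [Finset.card_univ]
  have h1 := pow_le_exp_mul (Real.sqrt_nonneg 5) sqrt_five_le_exp (Fintype.card κ)
  calc _ ≤ Real.exp (-0.263 * Fintype.card ι) * Real.exp (0.81 * Fintype.card κ) := by gcongr
    _ = Real.exp (-0.263 * Fintype.card ι + 0.81 * Fintype.card κ) := by rw [Real.exp_add]
    _ ≤ Real.exp (-0.1 * Fintype.card ι) := by
      refine Real.exp_le_exp.2 ?_
      have : (0 : ℝ) ≤ Fintype.card κ := Nat.cast_nonneg _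
      linarith
    _ ≤ _ := by linarith [Real.exp_pos (-0.1 * Fintype.card ι)]

end FewColumns

/-- The set `P` need not be measurable. -/
theorem one_sub_le_measureReal_of_subset {Ω : Type*} [MeasurableSpace Ω] {μ : Measure Ω}
    [IsProbabilityMeasure μ] {P E₁ E₂ : Set Ω} {ε : ℝ} (hε : 0 ≤ ε) (h : Pᶜ ⊆ E₁ ∪ E₂)
    (h₁ : μ E₁ ≤ ENNReal.ofReal ε) (h₂ : μ E₂ ≤ ENNReal.ofReal ε) : 1 - 2 * ε ≤ μ.real P := by
  have h3 : μ.real E₁ ≤ ε := ENNReal.toReal_le_of_le_ofReal hε h₁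
  have h4 : μ.real E₂ ≤ ε := ENNReal.toReal_le_of_le_ofReal hε h₂
  have h5 : (Set.univ : Set Ω) ⊆ P ∪ (E₁ ∪ E₂) := fun ω _ => by
    by_cases hω : ω ∈ P
    exacts [Or.inl hω, Or.inr (h hω)]
  have h6 := measureReal_mono (μ := μ) h5
  have h7 := measureReal_union_le (μ := μ) P (E₁ ∪ E₂)
  have h8 := measureReal_union_le (μ := μ) E₁ E₂
  rw [probReal_univ] at h6
  linarith

theorem mainTheorem2 {Ω : Type*} [MeasurableSpace Ω] (μ : Measure Ω) [IsProbabilityMeasure μ]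
    (m n m₁ n₁ k : ℕ) (hm : (m₁ : ℝ) = Real.sqrt m) (hn : (n₁ : ℝ) = Real.sqrt n)
    (X₀ : Matrix (Fin n₁) (Fin n₁) ℝ) (hk : matrixL0 X₀ = k)
    (hkn : (k : ℝ) ≤ Real.sqrt n / 2)
    (A B : Ω → Matrix (Fin m₁) (Fin n₁) ℝ)
    (hmeas : ∀ e, Measurable (allEntries A B e))
    (hindep : iIndepFun (allEntries A B) μ)
    (hsub : ∀ e, IsStrictlySubGaussian (allEntries A B e) (1 / (m : ℝ≥0)) μ)
    (hmk : 225 * (k : ℝ) ^ 2 * (Real.log ((n : ℝ) / (k : ℝ) ^ 2)) ^ 2 ≤ (m : ℝ)) :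
    1 - 4 * Real.exp (-0.1 * Real.sqrt m) ≤ μ.real {ω | PerfectRecovery (A ω) (B ω) X₀} := by
  have hm2 : (m₁ : ℝ) ^ 2 = m := by rw [hm, Real.sq_sqrt (Nat.cast_nonneg _)]
  have hn2 : (n₁ : ℝ) ^ 2 = n := by rw [hn, Real.sq_sqrt (Nat.cast_nonneg _)]
  rw [← hm]
  rw [← hn] at hkn
  rcases Nat.eq_zero_or_pos m₁ with h0 | hm₁
  · -- the claimed lower bound is negative
    have hz : (m₁ : ℝ) = 0 := by rw [h0, Nat.cast_zero]
    have : (0 : ℝ) ≤ μ.real {ω | PerfectRecovery (A ω) (B ω) X₀} := measureReal_nonneg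
    rw [hz, mul_zero, Real.exp_zero]
    linarith
  rcases Nat.eq_zero_or_pos k with h0 | hkpos
  · -- `X₀ = 0` is the only matrix of norm zero
    have hX : X₀ = 0 := by
      by_contra hne
      obtain ⟨i, j, hij⟩ : ∃ i j, X₀ i j ≠ 0 := by
        by_contra! hall
        exact hne (by ext i j; exact hall i j)
      rw [matrixL0_eq_card, h0, Finset.card_eq_zero] at hk
      have : (i, j) ∈ (∅ : Finset (Fin n₁ × Fin n₁)) := hk ▸ (by simpa using hij)
      simp at this
    have hall : {ω | PerfectRecovery (A ω) (B ω) X₀} = Set.univ := by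
      refine Set.eq_univ_of_forall fun ω => perfectRecovery_of_forall_lt fun H _ hne => ?_
      rw [hX, zero_add]
      simpa [matrixL1] using matrixL1_pos H hne
    rw [hall, probReal_univ]
    linarith [Real.exp_pos (-0.1 * (m₁ : ℝ))]
  have hm₁' : (0 : ℝ) < m₁ := by exact_mod_cast hm₁
  have hk' : (0 : ℝ) < k := by exact_mod_cast hkpos
  have hx2 : (2 : ℝ) ≤ n₁ / k := by rw [le_div_iff₀ hk']; linarith
  -- the hypothesis on `m`, after taking square roots
  have hmlog : 30 * (k * Real.log (n₁ / k)) ≤ m₁ := by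
    have e : Real.log ((n : ℝ) / (k : ℝ) ^ 2) = 2 * Real.log (n₁ / k) := by
      rw [← hn2, ← div_pow, Real.log_pow]
      norm_num
    rw [e, ← hm2] at hmk
    refine (le_abs_self _).trans (abs_le_of_sq_le_sq (le_of_eq_of_le ?_ hmk) hm₁'.le)
    ring
  -- multiplied by `m₁`, the entries have variance one
  have hc : (m₁ : ℝ) ^ 2 * ((1 / (m : ℝ≥0) : ℝ≥0) : ℝ) = 1 := by
    push_cast
    rw [← hm2]
    field_simp
  set a : Fin n₁ → Ω → EuclideanSpace ℝ (Fin m₁) :=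
    fun j ω => WithLp.toLp 2 fun i => (m₁ : ℝ) * A ω i j
  set b : Fin n₁ → Ω → EuclideanSpace ℝ (Fin m₁) :=
    fun j ω => WithLp.toLp 2 fun i => (m₁ : ℝ) * B ω i j
  have ha : IsStdFamily a μ := isStdFamily_of_entries (ξ := fun j i ω => A ω i j)
    (fun j i => hmeas (Sum.inl (i, j)))
    (hindep.precomp (g := fun p : Fin n₁ × Fin m₁ => Sum.inl p.swap)
      (Sum.inl_injective.comp Prod.swap_injective)) (fun j i => hsub (Sum.inl (i, j))) hc
  have hb : IsStdFamily b μ := isStdFamily_of_entries (ξ := fun j i ω => B ω i j)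
    (fun j i => hmeas (Sum.inr (i, j)))
    (hindep.precomp (g := fun p : Fin n₁ × Fin m₁ => Sum.inr p.swap)
      (Sum.inr_injective.comp Prod.swap_injective)) (fun j i => hsub (Sum.inr (i, j))) hc
  have haA (ω : Ω) : columnMatrix (fun j => a j ω) = (m₁ : ℝ) • A ω := rfl
  have hbB (ω : Ω) : columnMatrix (fun j => b j ω) = (m₁ : ℝ) • B ω := rfl
  have e4 : 1 - 4 * Real.exp (-0.1 * (m₁ : ℝ)) = 1 - 2 * (2 * Real.exp (-0.1 * (m₁ : ℝ))) := by ring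
  rw [e4]
  rcases Nat.lt_or_ge n₁ (16 * k) with hsmall | hlarge
  · -- few columns: both matrices are injective
    have hx16 : (n₁ / k : ℝ) ≤ 16 := by
      rw [div_le_iff₀ hk']; exact_mod_cast hsmall.le
    have h5 : 5 * (Fintype.card (Fin n₁) : ℝ) ≤ Fintype.card (Fin m₁) := by
      rw [Fintype.card_fin, Fintype.card_fin]
      have h6 := div_six_le_log hx2 hx16
      have h7 : k * (n₁ / k / 6 : ℝ) ≤ k * Real.log (n₁ / k) := by gcongr
      have h8 : k * (n₁ / k / 6 : ℝ) = n₁ / 6 := by field_simp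
      linarith
    have h₁ := ha.measure_not_linearIndependent_le h5
    have h₂ := hb.measure_not_linearIndependent_le h5
    rw [Fintype.card_fin] at h₁ h₂
    refine one_sub_le_measureReal_of_subset (by positivity) (fun ω hω => ?_) h₁ h₂
    by_contra hcon
    simp only [Set.mem_union, Set.mem_ofPred_eq, not_or, not_not] at hcon
    refine hω (PerfectRecovery.of_smul hm₁'.ne' ?_)
    rw [← haA, ← hbB]
    exact perfectRecovery_of_linearIndependent hcon.1 hcon.2
  · -- many columns: both matrices have dual certificates
    have hS₁ := card_rowSupport_le X₀
    have hS₂ := card_rowSupport_le X₀ᵀ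
    rw [matrixL0_transpose] at hS₂
    rw [hk] at hS₁ hS₂
    have hsq := sum_signMatrix_sq X₀
    rw [hk] at hsq
    have hcompl (S : Finset (Fin n₁)) (hS : S.card ≤ k) : k ≤ (Sᶜ).card := by
      rw [Finset.card_compl, Fintype.card_fin]
      omega
    have h₁ := ha.measure_not_hasDualCertificate_le (S := rowSupport X₀)
      (rowSupport_nonempty X₀ (by omega)) hS₁ (signMatrix X₀)ᵀ (by
        rw [← hsq, Finset.sum_comm]
        refine Finset.sum_le_sum_of_subset_of_nonneg (Finset.subset_univ _) fun i _ _ => ?_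
        exact Finset.sum_nonneg fun _ _ => sq_nonneg _) (by rwa [Fintype.card_fin])
      (by rwa [Fintype.card_fin, Fintype.card_fin])
    have h₂ := hb.measure_not_hasDualCertificate_le (S := rowSupport X₀ᵀ)
      (rowSupport_nonempty X₀ᵀ (by rw [matrixL0_transpose]; omega)) hS₂ (signMatrix X₀) (by
        rw [← hsq]
        refine Finset.sum_le_sum fun i _ => ?_
        exact Finset.sum_le_sum_of_subset_of_nonneg (Finset.subset_univ _) fun _ _ _ => sq_nonneg _)
      (by rwa [Fintype.card_fin]) (by rwa [Fintype.card_fin, Fintype.card_fin])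
    rw [Fintype.card_fin] at h₁ h₂
    refine one_sub_le_measureReal_of_subset (by positivity) (fun ω hω => ?_) h₁ h₂
    by_contra hcon
    simp only [Set.mem_union, Set.mem_ofPred_eq, not_or, not_not] at hcon
    refine hω (PerfectRecovery.of_smul hm₁'.ne' ?_)
    rw [← haA, ← hbB]
    exact perfectRecovery_of_hasDualCertificate
      (fun i hi j => eq_zero_of_notMem_rowSupport X₀ hi j)
      (fun j hj i => eq_zero_of_notMem_rowSupport X₀ᵀ hj i) hcon.1 hcon.2 hkpos
      (hcompl _ hS₁) (hcompl _ hS₂)
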